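/- Let $d\ge 2$ and $\lambda\in\mathbb{R}$, $\lambda\neq 0$. On $\mathbb{R}^{d+1}$ put $\langle x,y\rangle=\sum_{i=1}^{d}x_iy_i+\operatorname{sign}(\lambda)\,x_{d+1}y_{d+1}$. The real space form of curvature $\lambda$ is $\mathrm{Sp}^d(\lambda)=\{x:\langle x,x\rangle=1/\lambda\}$ if $\lambda>0$, and $\mathrm{Sp}^d(\lambda)=\{x:\langle x,x\rangle=-1/|\lambda|,\ x_{d+1}>0\}$ if $\lambda<0$; for $\lambda<0$ the Lorentz space form is $\mathrm{Sp}^d_1(\lambda)=\{x:\langle x,x\rangle=1/|\lambda|\}$. A convex body $K\subset\mathrm{Sp}^d(\lambda)$ is a compact subset that contains the geodesic segment joining any two of its points whenever that segment is unique. It is of class $\mathcal{C}^2_+$ if its boundary relative to $\mathrm{Sp}^d(\lambda)$ is a $\mathcal{C}^2$-smooth embedded hypersurface whose Gauss--Kronecker curvature is positive at every point. The dual body is $$K^*=\{y\in\mathrm{Sp}^d(1/\lambda):\langle x,y\rangle\ge 0\ \ \forall x\in K\}\ \text{ if }\lambda>0,\qquad K^*=\{y\in\mathrm{Sp}^d_1(1/\lambda):\langle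 x,y\rangle\le 0\ \ \forall x\in K\}\ \text{ if }\lambda<0.$$ $H^\lambda_{d-1}(K,u)$ and $H^{1/\lambda}_{d-1}(K^*,v)$ denote the intrinsic Gauss--Kronecker curvatures of the boundary of $K$ in $\mathrm{Sp}^d(\lambda)$, and of the boundary of $K^*$ in $\mathrm{Sp}^d(1/\lambda)$ (if $\lambda>0$) or $\mathrm{Sp}^d_1(1/\lambda)$ (if $\lambda<0$): the quotient $\det(h_{ij})/\det(g_{ij})$, where $g$ is the first fundamental form induced by $\langle\cdot,\cdot\rangle$ and $h$ is the second fundamental form with respect to the inner unit normal $\nu$ (the normal component of $\nabla_XY$ is $h(X,Y)\,\nu$). **Theorem.** Let $K\subset\mathrm{Sp}^d(\lambda)$ be a convex body of class $\mathcal{C}^2_+$. For every $u\in\operatorname{bd}K$ there is a unique point $u^*\in K^*$ with $\langle u,u^*\rangle=0$. It is a boundary point of $K^*$, and $u^*=\sqrt{\lambda}\,\nu$ with $\nu$ the inner unit normal of $K$ at $u$ if $\lambda>0$, respectively $u^*=\sqrt{|\lambda|}\,n$ with $n$ the outer unit normal of $K$ at $u$ if $\lambda<0$. The boundary of $K^*$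 is a $\mathcal{C}^2$-smooth embedded hypersurface near $u^*$, so that its Gauss--Kronecker curvature at $u^*$ is defined, and $$H^\lambda_{d-1}(K,u)\;H^{1/\lambda}_{d-1}(K^*,u^*)=1 .$$ -/

import Mathlib

noncomputable section

namespace SpaceForm

/-- The ambient coordinate space of dimension `d + 1`. -/
abbrev Ambient (d : ℕ) : Type := EuclideanSpace ℝ (Fin (d + 1))

/-- The bilinear form `x₁y₁ + ⋯ + x_d y_d + sign(lam) x_{d+1} y_{d+1}`: the Euclidean product
for `lam > 0` and the Lorentz--Minkowski product for `lam < 0`. -/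
def form {d : ℕ} (lam : ℝ) (x y : Ambient d) : ℝ :=
  (∑ i : Fin d, x i.castSucc * y i.castSucc)
    + Real.sign lam * (x (Fin.last d) * y (Fin.last d))

/-- The real space form of dimension `d` and curvature `lam ≠ 0`: the sphere `x · x = 1 / lam`
for `lam > 0`, the upper sheet of the hyperboloid `x ∘ x = -1 / |lam|` for `lam < 0`. -/
def realSpaceForm (d : ℕ) (lam : ℝ) : Set (Ambient d) :=
  {x | form lam x x = 1 / lam ∧ (lam < 0 → 0 < x (Fin.last d))}

/-- The Lorentz space form (de Sitter space) `x ∘ x = 1 / |lam|`, for `lam < 0`. -/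
def lorentzSpaceForm (d : ℕ) (lam : ℝ) : Set (Ambient d) :=
  {x | form lam x x = 1 / |lam|}

/-- The space that contains the dual bodies of the convex bodies of curvature `lam`. -/
def dualSpaceForm (d : ℕ) (lam : ℝ) : Set (Ambient d) :=
  if 0 < lam then realSpaceForm d (1 / lam) else lorentzSpaceForm d (1 / lam)

/-- The dual body `K^*`. -/
def dualBody {d : ℕ} (lam : ℝ) (K : Set (Ambient d)) : Set (Ambient d) :=
  if 0 < lam then {y ∈ realSpaceForm d (1 / lam) | ∀ x ∈ K, 0 ≤ form lam x y}
  else {y ∈ lorentzSpaceForm d (1 / lam) | ∀ x ∈ K, form lam x y ≤ 0}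

/-- For non-antipodal `x, y` in the real space form `M`, the unique shortest geodesic segment from
`x` to `y`: the part of `M` in the cone spanned by `x` and `y`. -/
def geodesicSegment {d : ℕ} (M : Set (Ambient d)) (x y : Ambient d) : Set (Ambient d) :=
  {z ∈ M | ∃ a b : ℝ, 0 ≤ a ∧ 0 ≤ b ∧ z = a • x + b • y}

/-- A convex body of the real space form: a compact subset that contains the geodesic segment
between any two of its points for which this segment is unique (that is, non-antipodal points). -/
structure IsConvexBody {d : ℕ} (lam : ℝ) (K : Set (Ambient d)) : Prop where
  subset : K ⊆ realSpaceForm d lam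
  isCompact : IsCompact K
  convex : ∀ x ∈ K, ∀ y ∈ K, y ≠ -x → geodesicSegment (realSpaceForm d lam) x y ⊆ K

/-- The boundary of `K` relative to the space `M`. -/
def bd {d : ℕ} (M K : Set (Ambient d)) : Set (Ambient d) :=
  M ∩ closure K ∩ closure (M \ K)

/-- `φ` is, on a neighbourhood of the origin of `ℝ^{d-1}`, a `C²` embedding onto a relative
neighbourhood of `u` in the set `Γ`, with `φ 0 = u`; that is, `Γ` is near `u` a `C²`-smooth
embedded submanifold of dimension `d - 1`, and `φ` is a local parametrization of it. -/
def IsC2Parametrization {d : ℕ} (Γ : Set (Ambient d)) (u : Ambient d)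
    (φ : EuclideanSpace ℝ (Fin (d - 1)) → Ambient d) : Prop :=
  φ 0 = u ∧
  ∃ W : Set (EuclideanSpace ℝ (Fin (d - 1))), IsOpen W ∧ 0 ∈ W ∧
    ContDiffOn ℝ 2 φ W ∧
    (∀ p ∈ W, Function.Injective (fderiv ℝ φ p)) ∧
    Topology.IsEmbedding (W.domRestrict φ) ∧
    ∃ U : Set (Ambient d), IsOpen U ∧ φ '' W = Γ ∩ U

/-- `ν` is an inner unit normal of the convex set `K` at its boundary point `u`: a unit vector
(time-like ones are allowed), tangent to the quadric at `u`, such that `K` lies in the closed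
half-space that is bounded by the hyperplane orthogonal to `ν` and contains `ν`. -/
def IsInnerUnitNormal {d : ℕ} (lam : ℝ) (K : Set (Ambient d)) (u ν : Ambient d) : Prop :=
  (form lam ν ν = 1 ∨ form lam ν ν = -1) ∧ form lam ν u = 0 ∧
  ∀ y ∈ K, 0 ≤ form lam ν ν * form lam ν y

/-- The matrix of the first fundamental form at the origin of a parametrization. -/
def firstFundamentalForm {d : ℕ} (lam : ℝ) (φ : EuclideanSpace ℝ (Fin (d - 1)) → Ambient d) :
    Matrix (Fin (d - 1)) (Fin (d - 1)) ℝ :=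
  Matrix.of fun i j =>
    form lam (fderiv ℝ φ 0 (EuclideanSpace.single i 1)) (fderiv ℝ φ 0 (EuclideanSpace.single j 1))

/-- The matrix `h` of the second fundamental form at the origin of a parametrization: the
component of `∂ᵢ∂ⱼφ` along the unit normal `ν` is `h i j • ν`. As `ν` is orthogonal to the position
vector, this is also the normal component of the covariant derivative of the quadric. The factor
`form lam ν ν` is `1` for space-like and `-1` for time-like `ν`. -/
def secondFundamentalForm {d : ℕ} (lam : ℝ) (φ : EuclideanSpace ℝ (Fin (d - 1)) → Ambient d)
    (ν : Ambient d) : Matrix (Fin (d - 1)) (Fin (d - 1)) ℝ :=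
  Matrix.of fun i j =>
    form lam ν ν * form lam
      (fderiv ℝ (fderiv ℝ φ) 0 (EuclideanSpace.single i 1) (EuclideanSpace.single j 1)) ν

/-- The boundary of `K` relative to the quadric `M` is near `u` a `C²`-smooth embedded
hypersurface, and its Gauss--Kronecker curvature at `u`, that is, the product of the principal
curvatures with respect to the inner unit normal, is `κ`. -/
def HasGaussKronecker {d : ℕ} (lam : ℝ) (M K : Set (Ambient d)) (u : Ambient d) (κ : ℝ) : Prop :=
  ∃ (φ : EuclideanSpace ℝ (Fin (d - 1)) → Ambient d) (ν : Ambient d),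
    IsC2Parametrization (bd M K) u φ ∧
    IsInnerUnitNormal lam K u ν ∧
    (∀ v, form lam ν (fderiv ℝ φ 0 v) = 0) ∧
    κ = (secondFundamentalForm lam φ ν).det / (firstFundamentalForm lam φ).det

/-- `K` is of class `C²₊`: its boundary is a `C²`-smooth embedded hypersurface of the real space
form, and the Gauss--Kronecker curvature is positive at every boundary point. -/
def IsC2Plus {d : ℕ} (lam : ℝ) (K : Set (Ambient d)) : Prop :=
  ∀ u ∈ bd (realSpaceForm d lam) K,
    ∃ κ : ℝ, 0 < κ ∧ HasGaussKronecker lam (realSpaceForm d lam) K u κ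

end SpaceForm

end

/-! Write s for the sign of λ, and let y be the scaled normal of K at u. The second fundamental form
of bd K at u is semidefinite because K lies on one side of its tangent hyperplane, and its
determinant is nonzero, so it is definite. Hence bd K leaves the hyperplane orthogonal to y
quadratically (`IsStrictContact.growth`), a statement that does not depend on the parametrization.
With convexity it follows that this hyperplane meets K in u alone.

Duality is the relation ⟨x, z⟩ = 0 between boundary points x of K and z of K*: each of the two is a
normal vector at the other. Compactness of K gives every boundary point of K* a contact point on K,
and uniqueness of the contact at y makes the choice of contact points continuous at y
(`IsStrictContact.exists_contact_param`).

The delicate point is that bd K* is C², although the normal field of a C² hypersurface is only C¹.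
Normals near y are written Y(w) = y + dφ₀(w) + a(w) u, where the contact parameter p(w) comes from
the implicit function theorem and is C¹. Since Y(w) annihilates the tangent space at φ(p(w)), the
derivative of a involves φ(p(w)) but not the derivative of p. So this derivative is C¹ and a is C²
(`contDiffAt_contactVector_two`). Rescaling Y to the dual quadric parametrizes bd K*
(`IsStrictContact.exists_dual_param`).

For the curvatures, let φ and ψ parametrize bd K and bd K* near u and y. Let A and C be the matrices
of ⟨y, ∂∂φ⟩ and ⟨u, ∂∂ψ⟩, and B that of ⟨∂φ, ∂ψ⟩. Differentiating the two tangency relations along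
pairs in contact gives C = Bᵀ A⁻¹ B, so det A · det C = (det B)² (`IsStrictContact.det_mul_det`).
Both tangent spaces are the orthogonal complement of u and y, so (det B)² is the product of the two
Gram determinants (`det_mixedForm_sq`). The unit normals are ν with y = s√|λ| ν, and √|λ| u for K*;
the resulting powers of s√|λ| cancel. -/

noncomputable section

open Filter Topology
open scoped Matrix

namespace SpaceForm

/-! ### The ambient form, its quadrics and the dual body -/

section Form

variable {d : ℕ} {lam : ℝ}

/-- The form of the ambient space as a continuous bilinear map. -/
def formL (d : ℕ) (lam : ℝ) : Ambient d →L[ℝ] Ambient d →L[ℝ] ℝ :=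
  (LinearMap.mk₂ ℝ (form (d := d) lam)
    (fun x x' y => by simp only [form, PiLp.add_apply, add_mul, mul_add, Finset.sum_add_distrib]; ring)
    (fun c x y => by
      simp only [form, PiLp.smul_apply, smul_eq_mul, mul_add, Finset.mul_sum, mul_assoc]; ring)
    (fun x y y' => by simp only [form, PiLp.add_apply, mul_add, Finset.sum_add_distrib]; ring)
    (fun c x y => by
      simp only [form, PiLp.smul_apply, smul_eq_mul, mul_add, Finset.mul_sum]
      congr 1
      · exact Finset.sum_congr rfl fun i _ => by ring
      · ring)).toContinuousBilinearMap

theorem formL_apply (x y : Ambient d) : formL d lam x y = form lam x y := rfl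

theorem form_comm (x y : Ambient d) : form lam x y = form lam y x := by
  simp only [form, mul_comm]

theorem form_add_left (x y z : Ambient d) : form lam (x + y) z = form lam x z + form lam y z := by
  simp [← formL_apply]

theorem form_add_right (x y z : Ambient d) : form lam x (y + z) = form lam x y + form lam x z := by
  simp [← formL_apply]

theorem form_sub_left (x y z : Ambient d) : form lam (x - y) z = form lam x z - form lam y z := by
  simp [← formL_apply]

theorem form_sub_right (x y z : Ambient d) : form lam x (y - z) = form lam x y - form lam x z := by
  simp [← formL_apply]

theorem form_smul_left (c : ℝ) (x y : Ambient d) : form lam (c • x) y = c * form lam x y := by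
  simp [← formL_apply]

theorem form_smul_right (c : ℝ) (x y : Ambient d) : form lam x (c • y) = c * form lam x y := by
  simp [← formL_apply]

theorem form_neg_left (x y : Ambient d) : form lam (-x) y = -form lam x y := by
  simp [← formL_apply]

theorem form_zero_left (y : Ambient d) : form lam 0 y = 0 := by
  simp [← formL_apply]

theorem continuous_form : Continuous fun z : Ambient d × Ambient d => form lam z.1 z.2 := by
  have : Continuous fun z : Ambient d × Ambient d => formL d lam z.1 z.2 := by fun_prop
  exact this

theorem continuous_form_left (y : Ambient d) : Continuous fun x => form lam x y :=
  continuous_form.comp (by fun_prop : Continuous fun x : Ambient d => (x, y))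

theorem continuous_form_right (x : Ambient d) : Continuous fun y => form lam x y :=
  continuous_form.comp (by fun_prop : Continuous fun y : Ambient d => (x, y))

theorem continuous_form_self : Continuous fun x : Ambient d => form lam x x :=
  continuous_form.comp (by fun_prop : Continuous fun x : Ambient d => (x, x))

/-- Only the sign of the curvature enters the form, so K and K* live in the same ambient geometry.
-/
theorem form_one_div (lam : ℝ) : (form (1 / lam) : Ambient d → Ambient d → ℝ) = form lam := by
  have h : Real.sign (1 / lam) = Real.sign lam := by
    rw [one_div]
    rcases lt_trichotomy lam 0 with h | h | h
    · rw [Real.sign_of_neg h, Real.sign_of_neg (inv_lt_zero.2 h)]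
    · simp [h]
    · rw [Real.sign_of_pos h, Real.sign_of_pos (inv_pos.2 h)]
  funext x y
  simp only [form, h]

theorem sign_mul_sign (h : lam ≠ 0) : Real.sign lam * Real.sign lam = 1 := by
  rcases lt_or_gt_of_ne h with h | h
  · simp [Real.sign_of_neg h]
  · simp [Real.sign_of_pos h]

theorem sign_mul_abs (h : lam ≠ 0) : Real.sign lam * |lam| = lam := by
  rcases lt_or_gt_of_ne h with h | h
  · simp [Real.sign_of_neg h, abs_of_neg h]
  · simp [Real.sign_of_pos h, abs_of_pos h]

/-- The tangent spaces of a real space form are positive definite. -/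
theorem form_self_pos (hlam : lam ≠ 0) {u v : Ambient d} (hu : u ∈ realSpaceForm d lam)
    (hvu : form lam v u = 0) (hv : v ≠ 0) : 0 < form lam v v := by
  have hne : (∑ i : Fin d, v i.castSucc * v i.castSucc) + v (Fin.last d) * v (Fin.last d) ≠ 0 := by
    intro h
    apply hv
    have h1 : 0 ≤ ∑ i : Fin d, v i.castSucc * v i.castSucc :=
      Finset.sum_nonneg fun i _ => mul_self_nonneg _
    have h2 := mul_self_nonneg (v (Fin.last d))
    have h3 : ∑ i : Fin d, v i.castSucc * v i.castSucc = 0 := by linarith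
    have h4 : v (Fin.last d) = 0 := mul_self_eq_zero.1 (by linarith)
    rw [Finset.sum_eq_zero_iff_of_nonneg fun i _ => mul_self_nonneg _] at h3
    ext i
    refine Fin.lastCases ?_ (fun j => ?_) i
    · simpa using h4
    · simpa using h3 j (Finset.mem_univ _)
  have h1 : 0 ≤ ∑ i : Fin d, v i.castSucc * v i.castSucc :=
    Finset.sum_nonneg fun i _ => mul_self_nonneg _
  have h2 := mul_self_nonneg (v (Fin.last d))
  rcases lt_or_gt_of_ne hlam with h | h
  · obtain ⟨hu1, hu2⟩ := hu
    have hu2 := hu2 h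
    have hneg : 1 / lam < 0 := one_div_neg.2 h
    simp only [form, Real.sign_of_neg h] at *
    have hcs := Finset.sum_mul_sq_le_sq_mul_sq Finset.univ (fun i : Fin d => v i.castSucc)
      (fun i : Fin d => u i.castSucc)
    simp only [pow_two] at hcs
    set S := ∑ i : Fin d, v i.castSucc * v i.castSucc
    set T := ∑ i : Fin d, u i.castSucc * u i.castSucc
    set R := ∑ i : Fin d, v i.castSucc * u i.castSucc
    set a := v (Fin.last d)
    set b := u (Fin.last d)
    have hR : R = a * b := by linarith
    have hT : T < b * b := by linarith
    rw [hR] at hcs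
    have hb : 0 < b * b := by positivity
    -- Reverse Cauchy–Schwarz: if S ≤ a², then (ab)² ≤ S T ≤ a² T < a² b² unless a = 0, and in that
    -- case v = 0.
    by_contra hcon
    have hSa : S ≤ a * a := by linarith
    have hT0 : 0 ≤ T := Finset.sum_nonneg fun i _ => mul_self_nonneg _
    rcases h2.eq_or_lt with ha | ha
    · apply hne
      linarith
    · have e1 : S * T ≤ a * a * T := mul_le_mul_of_nonneg_right hSa hT0
      have e2 : a * a * T < a * a * (b * b) := mul_lt_mul_of_pos_left hT ha
      nlinarith
  · simp only [form, Real.sign_of_pos h, one_mul]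
    exact lt_of_le_of_ne (by positivity) (Ne.symm hne)

/-- The linear map `(p, a, b) ↦ X p + a u + b y`. -/
def decompositionMap (X : EuclideanSpace ℝ (Fin (d - 1)) →L[ℝ] Ambient d) (u y : Ambient d) :
    EuclideanSpace ℝ (Fin (d - 1)) × ℝ × ℝ →ₗ[ℝ] Ambient d :=
  LinearMap.coprod X.toLinearMap
    (LinearMap.coprod (LinearMap.toSpanSingleton ℝ _ u) (LinearMap.toSpanSingleton ℝ _ y))

theorem decompositionMap_apply (X : EuclideanSpace ℝ (Fin (d - 1)) →L[ℝ] Ambient d)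
    (u y : Ambient d) (w : EuclideanSpace ℝ (Fin (d - 1)) × ℝ × ℝ) :
    decompositionMap X u y w = X w.1 + (w.2.1 • u + w.2.2 • y) := by
  simp [decompositionMap]

section Decomposition

variable {X : EuclideanSpace ℝ (Fin (d - 1)) →L[ℝ] Ambient d} {u y : Ambient d}

theorem decompositionMap_injective (hX : Function.Injective X) (hu : form lam u u ≠ 0)
    (hy : form lam y y ≠ 0) (huy : form lam u y = 0) (hXu : ∀ v, form lam (X v) u = 0)
    (hXy : ∀ v, form lam (X v) y = 0) : Function.Injective (decompositionMap X u y) := by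
  rw [injective_iff_map_eq_zero]
  rintro ⟨p, a, b⟩ h
  rw [decompositionMap_apply] at h
  simp only at h
  have ha := congrArg (form lam · u) h
  have hb := congrArg (form lam · y) h
  simp only [form_add_left, form_smul_left, hXu, hXy, huy, form_comm y u, form_zero_left,
    mul_zero, zero_add, add_zero, mul_eq_zero, hu, hy, or_false] at ha hb
  subst ha hb
  simp only [zero_smul, add_zero] at h
  have := hX (h.trans (map_zero X).symm)
  simp [this]

/-- An injectively parametrized subspace of codimension two, together with two orthogonal vectors
that are orthogonal to it and not isotropic, spans the ambient space. -/
theorem exists_decomposition (hd : 2 ≤ d) (hX : Function.Injective X) (hu : form lam u u ≠ 0)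
    (hy : form lam y y ≠ 0) (huy : form lam u y = 0) (hXu : ∀ v, form lam (X v) u = 0)
    (hXy : ∀ v, form lam (X v) y = 0) (z : Ambient d) :
    ∃ p, ∃ a b : ℝ, z = X p + a • u + b • y := by
  have hsurj : Function.Surjective (decompositionMap X u y) :=
    (LinearMap.injective_iff_surjective_of_finrank_eq_finrank (by
      simp only [Module.finrank_prod, finrank_euclideanSpace, Fintype.card_fin, Module.finrank_self]
      omega)).1 (decompositionMap_injective hX hu hy huy hXu hXy)
  obtain ⟨⟨p, a, b⟩, h⟩ := hsurj z
  exact ⟨p, a, b, by rw [← h, decompositionMap_apply, add_assoc]⟩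

/-- The projection `l` reads the parameter w off the vector y + dφ₀(w) + a u; it provides the left
inverse of the parametrization of bd K*. -/
theorem exists_coordinates (hX : Function.Injective X) (hu : form lam u u ≠ 0)
    (hy : form lam y y ≠ 0) (huy : form lam u y = 0) (hXu : ∀ v, form lam (X v) u = 0)
    (hXy : ∀ v, form lam (X v) y = 0) :
    ∃ l : Ambient d →L[ℝ] EuclideanSpace ℝ (Fin (d - 1)), (∀ v, l (X v) = v) ∧ l u = 0 ∧ l y = 0 := by
  obtain ⟨g, hg⟩ := (decompositionMap X u y).exists_leftInverse_of_injective
    (LinearMap.ker_eq_bot.2 (decompositionMap_injective hX hu hy huy hXu hXy))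
  have h : ∀ w, g (decompositionMap X u y w) = w := fun w => DFunLike.congr_fun hg w
  refine ⟨(LinearMap.fst ℝ _ _ ∘ₗ g).toContinuousLinearMap, fun v => ?_, ?_, ?_⟩
  · simpa [decompositionMap_apply] using congrArg Prod.fst (h (v, 0, 0))
  · simpa [decompositionMap_apply] using congrArg Prod.fst (h (0, 1, 0))
  · simpa [decompositionMap_apply] using congrArg Prod.fst (h (0, 0, 1))

end Decomposition

theorem form_self_ne_zero (hlam : lam ≠ 0) {u : Ambient d} (hu : u ∈ realSpaceForm d lam) :
    form lam u u ≠ 0 := by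
  rw [hu.1]
  exact one_div_ne_zero hlam

/-- The sheet condition is vacuous on the dual side, so both signs of the curvature give one and the
same equation. -/
theorem mem_dualSpaceForm_iff {y : Ambient d} :
    y ∈ dualSpaceForm d lam ↔ form lam y y = |lam| := by
  unfold dualSpaceForm
  split_ifs with h
  · simp only [realSpaceForm, Set.mem_ofPred_eq, form_one_div, one_div_one_div, abs_of_pos h]
    exact ⟨fun h => h.1, fun h' => ⟨h', fun h'' => absurd h'' (by simpa using h.le)⟩⟩
  · simp only [lorentzSpaceForm, Set.mem_ofPred_eq, form_one_div, abs_div, abs_one, one_div_one_div]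

/-- The factor `Real.sign lam` absorbs the two conventions for the inequality, and spherical and
hyperbolic duality are treated together from here on. -/
theorem mem_dualBody_iff (hlam : lam ≠ 0) {K : Set (Ambient d)} {y : Ambient d} :
    y ∈ dualBody lam K ↔ form lam y y = |lam| ∧ ∀ x ∈ K, 0 ≤ Real.sign lam * form lam x y := by
  have := mem_dualSpaceForm_iff (d := d) (lam := lam) (y := y)
  unfold dualBody
  unfold dualSpaceForm at this
  split_ifs at this ⊢ with h
  · rw [Set.mem_ofPred_eq, this, Real.sign_of_pos h]
    simp only [one_mul]
  · have h' : lam < 0 := lt_of_le_of_ne (not_lt.1 h) hlam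
    rw [Set.mem_ofPred_eq, this, Real.sign_of_neg h']
    simp only [neg_mul, one_mul, neg_nonneg]

/-- Rescaling to a quadric. -/
theorem tendsto_rescale {κ : ℝ} (hκ : κ ≠ 0) {u : Ambient d} (hu : form lam u u = κ) :
    Tendsto (fun z => (√(form lam z z / κ))⁻¹ • z) (𝓝 u) (𝓝 u) ∧
    ∀ᶠ z in 𝓝 u, 0 < (√(form lam z z / κ))⁻¹ ∧
      form lam ((√(form lam z z / κ))⁻¹ • z) ((√(form lam z z / κ))⁻¹ • z) = κ := by
  have hc : ContinuousAt (fun z : Ambient d => form lam z z / κ) u :=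
    (continuous_form_self.div_const κ).continuousAt
  have h1 : form lam u u / κ = 1 := by rw [hu, div_self hκ]
  constructor
  · have : ContinuousAt (fun z : Ambient d => (√(form lam z z / κ))⁻¹ • z) u := by
      refine ContinuousAt.smul (ContinuousAt.inv₀ hc.sqrt ?_) continuousAt_id
      simp [h1]
    simpa [ContinuousAt, h1] using this
  · have : ∀ᶠ z in 𝓝 u, 0 < form lam z z / κ := 
      hc.eventually (lt_mem_nhds (by simp only [h1]; exact one_pos))
    filter_upwards [this] with z hz
    refine ⟨by positivity, ?_⟩
    rw [form_smul_left, form_smul_right, ← mul_assoc, ← mul_inv, Real.mul_self_sqrt hz.le]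
    have : form lam z z ≠ 0 := fun h => by simp [h] at hz
    field_simp

theorem tendsto_rescale_realSpaceForm (hlam : lam ≠ 0) {u : Ambient d}
    (hu : u ∈ realSpaceForm d lam) :
    ∀ᶠ z in 𝓝 u, 0 < (√(form lam z z / (1 / lam)))⁻¹ ∧
      (√(form lam z z / (1 / lam)))⁻¹ • z ∈ realSpaceForm d lam := by
  have h := (tendsto_rescale (one_div_ne_zero hlam) hu.1).2
  have h2 : ∀ᶠ z in 𝓝 u, lam < 0 → 0 < z (Fin.last d) := by
    by_cases hl : lam < 0
    · have hc : Continuous fun z : Ambient d => z (Fin.last d) := by fun_prop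
      filter_upwards [hc.continuousAt.eventually (lt_mem_nhds (hu.2 hl))] with z hz _ using hz
    · exact Eventually.of_forall fun z h => absurd h hl
  filter_upwards [h, h2] with z hz hz2
  exact ⟨hz.1, hz.2, fun h => by simpa using mul_pos hz.1 (hz2 h)⟩

end Form

/-! ### Second-order conditions at a minimum and an implicit function argument -/

section Calculus

variable {P : Type*} [NormedAddCommGroup P] [NormedSpace ℝ P]

/-- The second derivative at a local minimum is positive semidefinite. -/
theorem second_deriv_nonneg_of_isLocalMin {f : P → ℝ} {f' : P → P →L[ℝ] ℝ}
    {A : P →L[ℝ] P →L[ℝ] ℝ} (hf : ∀ᶠ p in 𝓝 0, HasFDerivAt f (f' p) p)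
    (hf' : HasFDerivAt f' A 0) (hmin : IsLocalMin f 0) (v : P) : 0 ≤ A v v := by
  by_contra! hneg
  have h0 : f' 0 = 0 := hmin.hasFDerivAt_eq_zero hf.self_of_nhds
  have hline : Tendsto (fun t : ℝ => t • v) (𝓝 0) (𝓝 0) := by
    have : Continuous fun t : ℝ => t • v := by fun_prop
    simpa using this.tendsto 0
  have hsm : ∀ t : ℝ, HasDerivAt (fun t : ℝ => t • v) v t := fun t => by
    simpa using (hasDerivAt_id t).smul_const v
  have hd : HasDerivAt (fun t : ℝ => f' (t • v) v) (A v v) 0 := by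
    have h1 : HasFDerivAt f' A ((0 : ℝ) • v) := by simpa using hf'
    have h2 := h1.comp_hasDerivAt (0 : ℝ) (hsm 0)
    exact ((ContinuousLinearMap.apply ℝ ℝ v).hasFDerivAt.comp_hasDerivAt (0 : ℝ) h2)
  -- The function t ↦ f'(t v) v vanishes at 0 with negative derivative, so it is negative for small
  -- t > 0, and f strictly decreases along the ray.
  have hslope := (hasDerivAt_iff_tendsto_slope.1 hd).eventually (gt_mem_nhds hneg)
  rw [eventually_nhdsWithin_iff] at hslope
  have hall := hslope.and ((hline.eventually hf).and (hline.eventually hmin))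
  obtain ⟨δ, hδ, hball⟩ := Metric.eventually_nhds_iff_ball.1 hall
  have hmem : ∀ t ∈ Set.Icc (0 : ℝ) (δ / 2), t ∈ Metric.ball (0 : ℝ) δ := by
    intro t ht
    rw [Metric.mem_ball, Real.dist_eq, sub_zero, abs_of_nonneg ht.1]
    linarith [ht.2]
  have hder : ∀ t ∈ Set.Icc (0 : ℝ) (δ / 2),
      HasDerivAt (fun t : ℝ => f (t • v)) (f' (t • v) v) t := fun t ht =>
    (hball t (hmem t ht)).2.1.comp_hasDerivAt t (hsm t)
  have hanti : StrictAntiOn (fun t : ℝ => f (t • v)) (Set.Icc 0 (δ / 2)) := by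
    refine strictAntiOn_of_deriv_neg (convex_Icc _ _)
      (fun t ht => (hder t ht).continuousAt.continuousWithinAt) fun t ht => ?_
    rw [interior_Icc] at ht
    have ht' : t ∈ Set.Icc (0 : ℝ) (δ / 2) := Set.Ioo_subset_Icc_self ht
    rw [(hder t ht').deriv]
    have hs := (hball t (hmem t ht')).1 (by simpa using ht.1.ne')
    simp only [slope_def_field, zero_smul, h0, zero_apply, sub_zero] at hs
    by_contra! hge
    exact absurd hs (not_lt.2 (div_nonneg hge ht.1.le))
  have h1 := hanti (Set.left_mem_Icc.2 (by linarith)) (Set.right_mem_Icc.2 (by linarith))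
    (by linarith : (0 : ℝ) < δ / 2)
  have h2 := (hball (δ / 2) (hmem _ (Set.right_mem_Icc.2 (by linarith)))).2.2
  simp only [zero_smul] at h1
  linarith

/-- A function with vanishing first and positive definite second derivative grows quadratically. -/
theorem exists_quadratic_growth [FiniteDimensional ℝ P] {f : P → ℝ} {f' : P → P →L[ℝ] ℝ}
    {A : P →L[ℝ] P →L[ℝ] ℝ} (hf : ∀ᶠ p in 𝓝 0, HasFDerivAt f (f' p) p)
    (hf' : HasFDerivAt f' A 0) (h0 : f' 0 = 0) (hA : ∀ v, v ≠ 0 → 0 < A v v) :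
    ∃ c > 0, ∀ᶠ p in 𝓝 0, f 0 + c * ‖p‖ ^ 2 ≤ f p := by
  obtain ⟨c, hc, hcA⟩ : ∃ c > 0, ∀ v, c * ‖v‖ ^ 2 ≤ A v v := by
    have hcont : Continuous fun v : P => A v v := by fun_prop
    -- The sphere is empty when P is trivial; otherwise the minimum of A on it serves as c.
    rcases (Metric.sphere (0 : P) 1).eq_empty_or_nonempty with hS | hS
    · refine ⟨1, one_pos, fun v => ?_⟩
      have : v = 0 := by
        by_contra hv
        have : ‖v‖⁻¹ • v ∈ Metric.sphere (0 : P) 1 := by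
          simp [norm_smul, norm_ne_zero_iff.2 hv]
        simp [hS] at this
      simp [this]
    · obtain ⟨w, hw, hmin⟩ := (isCompact_sphere (0 : P) 1).exists_isMinOn hS hcont.continuousOn
      have hw0 : w ≠ 0 := by rintro rfl; simp at hw
      refine ⟨A w w, hA w hw0, fun v => ?_⟩
      by_cases hv : v = 0
      · simp [hv]
      have hn : ‖v‖ ≠ 0 := norm_ne_zero_iff.2 hv
      have hm : ‖v‖⁻¹ • v ∈ Metric.sphere (0 : P) 1 := by simp [norm_smul, hn]
      have := hmin hm
      simp only [Set.mem_ofPred_eq, map_smul, smul_apply, smul_eq_mul] at this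
      calc A w w * ‖v‖ ^ 2 ≤ (‖v‖⁻¹ * (‖v‖⁻¹ * A v v)) * ‖v‖ ^ 2 := by gcongr
        _ = A v v := by field_simp
  -- The differentiability error uses up half of c, leaving f'(p) p ≥ (c/2)‖p‖²; integration along
  -- the ray from 0 to p halves it once more.
  refine ⟨c / 4, by positivity, ?_⟩
  have hsmall := hf'.isLittleO.def (half_pos hc)
  obtain ⟨δ, hδ, hball⟩ := Metric.eventually_nhds_iff_ball.1 (hsmall.and hf)
  have hlow : ∀ p ∈ Metric.ball (0 : P) δ, c / 2 * ‖p‖ ^ 2 ≤ f' p p := by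
    intro p hp
    have h1 := (hball p hp).1
    simp only [h0, sub_zero] at h1
    have h2 := (f' p - A p).le_opNorm p
    rw [sub_apply, Real.norm_eq_abs] at h2
    have h3 := (abs_le.1 (h2.trans (mul_le_mul_of_nonneg_right h1 (norm_nonneg p)))).1
    nlinarith [hcA p]
  filter_upwards [Metric.ball_mem_nhds (0 : P) hδ] with p hp
  have hmem : ∀ t ∈ Set.Icc (0 : ℝ) 1, t • p ∈ Metric.ball (0 : P) δ := by
    intro t ht
    rw [mem_ball_zero_iff] at hp ⊢
    rw [norm_smul, Real.norm_eq_abs, abs_of_nonneg ht.1]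
    nlinarith [norm_nonneg p, ht.2]
  have hder : ∀ t ∈ Set.Icc (0 : ℝ) 1, HasDerivAt (fun t : ℝ => f (t • p) - c / 4 * t ^ 2 * ‖p‖ ^ 2)
      (f' (t • p) p - c / 4 * (2 * t) * ‖p‖ ^ 2) t := by
    intro t ht
    have h1 : HasDerivAt (fun t : ℝ => t • p) p t := by
      simpa using (hasDerivAt_id t).smul_const p
    have h2 := (hball _ (hmem t ht)).2.comp_hasDerivAt t h1
    have h3 := ((hasDerivAt_pow 2 t).const_mul (c / 4)).mul_const (‖p‖ ^ 2)
    refine (h2.sub h3).congr_deriv ?_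
    simp
  have hmono : MonotoneOn (fun t : ℝ => f (t • p) - c / 4 * t ^ 2 * ‖p‖ ^ 2) (Set.Icc 0 1) := by
    refine monotoneOn_of_deriv_nonneg (convex_Icc _ _)
      (fun t ht => (hder t ht).continuousAt.continuousWithinAt)
      (fun t ht => (hder t (interior_subset ht)).differentiableAt.differentiableWithinAt)
      fun t ht => ?_
    rw [(hder t (interior_subset ht)).deriv]
    rw [interior_Icc] at ht
    have h1 := hlow _ (hmem t (Set.Ioo_subset_Icc_self ht))
    rw [map_smul, norm_smul, Real.norm_eq_abs, abs_of_pos ht.1, smul_eq_mul, mul_pow] at h1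
    -- The lower bound concerns f'(t p) applied to t p, hence the additional factor t, which is
    -- divided out afterwards.
    have h2 : 0 ≤ t * (f' (t • p) p - c / 4 * (2 * t) * ‖p‖ ^ 2) := by nlinarith
    exact nonneg_of_mul_nonneg_right h2 ht.1
  have := hmono (Set.left_mem_Icc.2 zero_le_one) (Set.right_mem_Icc.2 zero_le_one) zero_le_one
  simp only [zero_smul, one_smul] at this
  linarith

/-- The chain rule along the graph of `p`, on which `G` is constant. -/
theorem fderiv_apply_eq_zero_of_curve {Q Z : Type*} [NormedAddCommGroup Q] [NormedSpace ℝ Q]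
    [NormedAddCommGroup Z] [NormedSpace ℝ Z] {G : Q × P → Z} {z : Q × P}
    (hG : DifferentiableAt ℝ G z) {p : Q → P} {p' : Q →L[ℝ] P} (hpz : p z.1 = z.2)
    (hp : HasFDerivAt p p' z.1) (hc : ∀ᶠ q in 𝓝 z.1, G (q, p q) = G z) (q : Q) :
    fderiv ℝ G z (q, p' q) = 0 := by
  have hcurve : HasFDerivAt (fun q => (q, p q)) ((ContinuousLinearMap.id ℝ Q).prod p') z.1 :=
    (hasFDerivAt_id z.1).prodMk hp
  have h1 : HasFDerivAt G (fderiv ℝ G z) (z.1, p z.1) := by rw [hpz]; exact hG.hasFDerivAt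
  have h2 := h1.comp z.1 hcurve
  have h3 : HasFDerivAt (G ∘ fun q => (q, p q)) (0 : Q →L[ℝ] Z) z.1 :=
    (hasFDerivAt_const (G z) z.1).congr_of_eventuallyEq hc
  simpa using DFunLike.congr_fun (h2.unique h3) q

/-- If two functions of two variables are constant along a continuous curve of pairs `(q, p q)`,
and the partial derivative of the first one in the second variable is invertible, then the kernel of
the derivative of the first one is contained in the kernel of the derivative of the second one. -/
theorem fderiv_apply_eq_zero_of_implicit {Q Z₁ Z₂ : Type*} [CompleteSpace P] [NormedAddCommGroup Q]
    [NormedSpace ℝ Q] [CompleteSpace Q] [NormedAddCommGroup Z₁] [NormedSpace ℝ Z₁]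
    [CompleteSpace Z₁] [NormedAddCommGroup Z₂] [NormedSpace ℝ Z₂]
    {G₁ : Q × P → Z₁} {G₂ : Q × P → Z₂} {z : Q × P} (h₁ : ContDiffAt ℝ 1 G₁ z)
    (h₂ : DifferentiableAt ℝ G₂ z)
    (hinv : (fderiv ℝ G₁ z ∘L .inr ℝ Q P).IsInvertible) {p : Q → P}
    (hp : Tendsto p (𝓝 z.1) (𝓝 z.2)) (hG₁ : ∀ᶠ q in 𝓝 z.1, G₁ (q, p q) = G₁ z)
    (hG₂ : ∀ᶠ q in 𝓝 z.1, G₂ (q, p q) = G₂ z) {w : Q × P} (hw : fderiv ℝ G₁ z w = 0) :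
    fderiv ℝ G₂ z w = 0 := by
  have hpair : Tendsto (fun q => (q, p q)) (𝓝 z.1) (𝓝 z) := by
    have := tendsto_id.prodMk_nhds hp
    simpa using this
  -- Local uniqueness identifies the curve, only known to be continuous at the base point, with the
  -- implicit function; this makes it differentiable there.
  have heq : h₁.implicitFunction one_ne_zero hinv =ᶠ[𝓝 z.1] p := by
    filter_upwards [hG₁, hpair.eventually
      (h₁.eventually_apply_eq_iff_implicitFunction one_ne_zero hinv)] with q hq1 hq2
    exact hq2.1 hq1
  obtain ⟨p', hp'⟩ : ∃ p', HasFDerivAt p p' z.1 :=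
    ⟨_, (h₁.hasStrictFDerivAt_implicitFunction one_ne_zero hinv).hasFDerivAt.congr_of_eventuallyEq
      heq.symm⟩
  have hpz : p z.1 = z.2 := by
    rw [← heq.self_of_nhds, h₁.implicitFunction_apply_self]
  have hw2 : w.2 = p' w.1 := by
    have h1 := fderiv_apply_eq_zero_of_curve (h₁.differentiableAt one_ne_zero) hpz hp' hG₁ w.1
    have h2 : fderiv ℝ G₁ z (0, w.2 - p' w.1) = 0 := by
      have : ((0 : Q), w.2 - p' w.1) = w - (w.1, p' w.1) := by ext <;> simp
      rw [this, map_sub, hw, h1, sub_zero]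
    have h3 := hinv.injective (a₁ := w.2 - p' w.1) (a₂ := 0) (by
      simp only [ContinuousLinearMap.comp_apply, ContinuousLinearMap.inr_apply, h2]
      exact (map_zero _).symm)
    exact sub_eq_zero.1 h3
  have := fderiv_apply_eq_zero_of_curve h₂ hpz hp' hG₂ w.1
  rwa [← hw2] at this

/-- A linear map from a finite-dimensional space to its dual is invertible if it is injective. -/
theorem isInvertible_of_injective_dual {P : Type*} [NormedAddCommGroup P] [InnerProductSpace ℝ P]
    [FiniteDimensional ℝ P] {A : P →L[ℝ] P →L[ℝ] ℝ} (hA : Function.Injective A) :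
    A.IsInvertible := by
  have hfin : Module.finrank ℝ P = Module.finrank ℝ (P →L[ℝ] ℝ) := by
    rw [← (LinearMap.toContinuousLinearMap (𝕜 := ℝ) (E := P) (F' := ℝ)).finrank_eq]
    exact (Subspace.dual_finrank_eq).symm
  refine ⟨(LinearEquiv.ofInjectiveOfFinrankEq A.toLinearMap hA hfin).toContinuousLinearEquiv, ?_⟩
  ext p q
  rfl

end Calculus

/-! ### Differentiating pairings of two parametrized maps -/

section FormCalculus

variable {d : ℕ} {lam : ℝ}
  {P Q : Type*} [NormedAddCommGroup P] [NormedSpace ℝ P] [NormedAddCommGroup Q] [NormedSpace ℝ Q]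

theorem _root_.ContDiffAt.eventually_hasFDerivAt_of_two {F : Type*} [NormedAddCommGroup F]
    [NormedSpace ℝ F] {f : P → F} {p : P} (hf : ContDiffAt ℝ 2 f p) :
    ∀ᶠ q in 𝓝 p, HasFDerivAt f (fderiv ℝ f q) q := by
  filter_upwards [hf.eventually (by simp)] with q hq
  exact (hq.differentiableAt (by simp)).hasFDerivAt

theorem _root_.ContDiffAt.hasFDerivAt_fderiv {F : Type*} [NormedAddCommGroup F]
    [NormedSpace ℝ F] {f : P → F} {p : P} (hf : ContDiffAt ℝ 2 f p) :
    HasFDerivAt (fderiv ℝ f) (fderiv ℝ (fderiv ℝ f) p) p :=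
  ((hf.fderiv_right (m := 1) (by norm_num)).differentiableAt one_ne_zero).hasFDerivAt

/-- The differential in `p` of `form (g q) (φ p)`. -/
def partialDiff (lam : ℝ) (g : Q → Ambient d) (φ : P → Ambient d) (z : Q × P) : P →L[ℝ] ℝ :=
  (formL d lam (g z.1)).comp (fderiv ℝ φ z.2)

theorem contDiffAt_partialDiff {g : Q → Ambient d} {φ : P → Ambient d} {z : Q × P}
    (hg : ContDiffAt ℝ 1 g z.1) (hφ : ContDiffAt ℝ 2 φ z.2) :
    ContDiffAt ℝ 1 (partialDiff lam g φ) z := by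
  have h1 : ContDiffAt ℝ 1 (fun z : Q × P => formL d lam (g z.1)) z :=
    (formL d lam).contDiff.contDiffAt.comp z (hg.comp z contDiffAt_fst)
  have h2 : ContDiffAt ℝ 1 (fun z : Q × P => fderiv ℝ φ z.2) z :=
    (hφ.fderiv_right (m := 1) (by norm_num)).comp z contDiffAt_snd
  exact h1.clm_comp h2

theorem fderiv_partialDiff {g : Q → Ambient d} {φ : P → Ambient d} {z : Q × P}
    (hg : ContDiffAt ℝ 1 g z.1) (hφ : ContDiffAt ℝ 2 φ z.2) (w : Q × P) (v : P) :
    fderiv ℝ (partialDiff lam g φ) z w v = form lam (fderiv ℝ g z.1 w.1) (fderiv ℝ φ z.2 v)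
      + form lam (g z.1) (fderiv ℝ (fderiv ℝ φ) z.2 w.2 v) := by
  have h1 : HasFDerivAt (fun z : Q × P => formL d lam (g z.1))
      ((formL d lam).comp ((fderiv ℝ g z.1).comp (.fst ℝ Q P))) z :=
    (formL d lam).hasFDerivAt.comp z
      ((hg.differentiableAt one_ne_zero).hasFDerivAt.comp z hasFDerivAt_fst)
  have h2 : HasFDerivAt (fun z : Q × P => fderiv ℝ φ z.2)
      ((fderiv ℝ (fderiv ℝ φ) z.2).comp (.snd ℝ Q P)) z :=
    hφ.hasFDerivAt_fderiv.comp z hasFDerivAt_snd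
  have h3 := h1.clm_comp h2
  have h4 : partialDiff lam g φ = fun z => (formL d lam (g z.1)).comp (fderiv ℝ φ z.2) := rfl
  rw [h4, h3.fderiv]
  simp [formL_apply, add_comm]

end FormCalculus

/-! ### Boundary points, tangency and quadratic separation -/

section Boundary

section Parametrization

variable {d : ℕ} {Γ : Set (Ambient d)} {u : Ambient d}
  {φ : EuclideanSpace ℝ (Fin (d - 1)) → Ambient d}

theorem IsC2Parametrization.contDiffAt (h : IsC2Parametrization Γ u φ) : ContDiffAt ℝ 2 φ 0 := by
  obtain ⟨_, W, hW, h0, hc, _⟩ := h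
  exact hc.contDiffAt (hW.mem_nhds h0)

theorem IsC2Parametrization.eventually_mem (h : IsC2Parametrization Γ u φ) :
    ∀ᶠ p in 𝓝 0, φ p ∈ Γ := by
  obtain ⟨_, W, hW, h0, _, _, _, U, _, hU⟩ := h
  filter_upwards [hW.mem_nhds h0] with p hp
  have : φ p ∈ φ '' W := Set.mem_image_of_mem φ hp
  rw [hU] at this
  exact this.1

theorem IsC2Parametrization.eventually_injective (h : IsC2Parametrization Γ u φ) :
    ∀ᶠ p in 𝓝 0, Function.Injective (fderiv ℝ φ p) := by
  obtain ⟨_, W, hW, h0, _, hi, _⟩ := h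
  filter_upwards [hW.mem_nhds h0] with p hp using hi p hp

/-- A parametrization has a local inverse that is continuous at the base point. -/
theorem IsC2Parametrization.exists_inverse (h : IsC2Parametrization Γ u φ) :
    ∃ τ : Ambient d → EuclideanSpace ℝ (Fin (d - 1)),
      Tendsto τ (𝓝[Γ] u) (𝓝 0) ∧ ∀ᶠ x in 𝓝[Γ] u, φ (τ x) = x := by
  obtain ⟨hu, W, hW, h0, _, _, he, U, hUo, hU⟩ := h
  have huU : u ∈ U := by
    have : φ 0 ∈ φ '' W := Set.mem_image_of_mem φ h0
    rw [hU, hu] at this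
    exact this.2
  have hex : ∀ x, ∃ p, x ∈ Γ ∩ U → p ∈ W ∧ φ p = x := by
    intro x
    by_cases hx : x ∈ Γ ∩ U
    · rw [← hU] at hx
      obtain ⟨p, hp⟩ := hx
      exact ⟨p, fun _ => hp⟩
    · exact ⟨0, fun h => absurd h hx⟩
  choose τ hτ using hex
  have hev : ∀ᶠ x in 𝓝[Γ] u, x ∈ Γ ∩ U := by
    filter_upwards [self_mem_nhdsWithin, mem_nhdsWithin_of_mem_nhds (hUo.mem_nhds huU)]
      with x h1 h2 using ⟨h1, h2⟩
  -- Outside Γ ∩ U the value of τ is irrelevant; its limit comes from the topology that the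
  -- embedding induces on W.
  refine ⟨τ, ?_, hev.mono fun x hx => (hτ x hx).2⟩
  refine tendsto_def.2 fun V hV => ?_
  have hV' : ((↑) : W → _) ⁻¹' V ∈ 𝓝 (⟨0, h0⟩ : W) := continuous_subtype_val.continuousAt hV
  rw [he.nhds_eq_comap, mem_comap] at hV'
  obtain ⟨N, hN, hNV⟩ := hV'
  have hN' : N ∈ 𝓝 u := by simpa [hu] using hN
  filter_upwards [hev, mem_nhdsWithin_of_mem_nhds hN'] with x hx hxN
  obtain ⟨h1, h2⟩ := hτ x hx
  have : (⟨τ x, h1⟩ : W) ∈ W.domRestrict φ ⁻¹' N := by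
    simpa [Set.domRestrict_apply, h2] using hxN
  exact hNV this

end Parametrization

section Derivatives

variable {d : ℕ} {lam : ℝ} {P : Type*} [NormedAddCommGroup P] [NormedSpace ℝ P]

/-- The first-order condition at a minimum. It yields all tangency relations, for K with y in K*
fixed and for K* with a point of K fixed; c is the sign of λ. -/
theorem form_fderiv_eq_zero_of_nonneg {φ : P → Ambient d} {p : P} (hφ : DifferentiableAt ℝ φ p)
    {y : Ambient d} {c : ℝ} (hc : c ≠ 0) (hnn : ∀ᶠ q in 𝓝 p, 0 ≤ c * form lam (φ q) y)
    (h0 : form lam (φ p) y = 0) (v : P) : form lam (fderiv ℝ φ p v) y = 0 := by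
  have h1 : HasFDerivAt (fun q => c * form lam (φ q) y)
      (c • (formL d lam y).comp (fderiv ℝ φ p)) p := by
    have := ((formL d lam y).hasFDerivAt.comp p hφ.hasFDerivAt).const_mul c
    refine this.congr_of_eventuallyEq (Eventually.of_forall fun q => ?_)
    simp [formL_apply, form_comm y]
  have hmin : IsLocalMin (fun q => c * form lam (φ q) y) p := by
    filter_upwards [hnn] with q hq
    simpa [h0] using hq
  have := DFunLike.congr_fun (hmin.hasFDerivAt_eq_zero h1) v
  simpa [formL_apply, hc, form_comm y] using this

theorem form_fderiv_self_eq_zero {φ : P → Ambient d} {p : P} (hφ : DifferentiableAt ℝ φ p)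
    {κ : ℝ} (hκ : ∀ᶠ q in 𝓝 p, form lam (φ q) (φ q) = κ) (v : P) :
    form lam (fderiv ℝ φ p v) (φ p) = 0 := by
  have h1 := (formL d lam).hasFDerivAt_of_bilinear hφ.hasFDerivAt hφ.hasFDerivAt
  have h2 : HasFDerivAt (fun q => formL d lam (φ q) (φ q)) (0 : P →L[ℝ] ℝ) p :=
    (hasFDerivAt_const κ p).congr_of_eventuallyEq hκ
  have h3 := DFunLike.congr_fun (h1.unique h2) v
  simp only [add_apply, ContinuousLinearMap.precompR_apply, ContinuousLinearMap.precompL_apply,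
    ContinuousLinearMap.compL_apply, ContinuousLinearMap.comp_apply, formL_apply, zero_apply] at h3
  rw [form_comm (φ p)] at h3
  linarith

/-- The differential and the second differential of a linear functional along a map. -/
theorem hasFDerivAt_clm_comp_fderiv {φ : P → Ambient d} {p : P} (hφ : ContDiffAt ℝ 2 φ p)
    (l : Ambient d →L[ℝ] ℝ) :
    (∀ᶠ q in 𝓝 p, HasFDerivAt (fun q => l (φ q)) (l.comp (fderiv ℝ φ q)) q) ∧
    HasFDerivAt (fun q => l.comp (fderiv ℝ φ q))
      ((ContinuousLinearMap.compL ℝ P (Ambient d) ℝ l).comp (fderiv ℝ (fderiv ℝ φ) p)) p :=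
  ⟨hφ.eventually_hasFDerivAt_of_two.mono fun q hq => l.hasFDerivAt.comp q hq,
    (ContinuousLinearMap.compL ℝ P (Ambient d) ℝ l).hasFDerivAt.comp p hφ.hasFDerivAt_fderiv⟩

end Derivatives

variable {d : ℕ} {lam : ℝ} {K : Set (Ambient d)} {u y : Ambient d}
  {φ : EuclideanSpace ℝ (Fin (d - 1)) → Ambient d}

theorem bd_subset (hK : IsConvexBody lam K) : bd (realSpaceForm d lam) K ⊆ K := fun x hx => by
  have := hx.1.2
  rwa [hK.isCompact.isClosed.closure_eq] at this

theorem isClosed_dualBody (hlam : lam ≠ 0) : IsClosed (dualBody lam K) := by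
  have : dualBody lam K = {y | form lam y y = |lam|} ∩
      ⋂ x ∈ K, {y | 0 ≤ Real.sign lam * form lam x y} := by
    ext y
    simp [mem_dualBody_iff hlam]
  rw [this]
  exact (isClosed_eq continuous_form_self continuous_const).inter
    (isClosed_biInter fun x _ => isClosed_le continuous_const
      (continuous_const.mul (continuous_form_right x)))

theorem bd_dual_subset (hlam : lam ≠ 0) : bd (dualSpaceForm d lam) (dualBody lam K) ⊆
    dualBody lam K := fun x hx => by
  have := hx.1.2
  rwa [(isClosed_dualBody hlam).closure_eq] at this

/-- Moving u slightly in the direction −s y and rescaling to the quadric makes the pairing with y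
violate the inequality that defines K*, so the moved point is outside K. -/
theorem mem_bd_of_form_eq_zero (hlam : lam ≠ 0) (hK : IsConvexBody lam K) (hu : u ∈ K)
    (hy : y ∈ dualBody lam K) (huy : form lam u y = 0) : u ∈ bd (realSpaceForm d lam) K := by
  have huM := hK.subset hu
  refine ⟨⟨huM, subset_closure hu⟩, ?_⟩
  rw [mem_dualBody_iff hlam] at hy
  have hline : Tendsto (fun t : ℝ => u - (t * Real.sign lam) • y) (𝓝[>] 0) (𝓝 u) := by
    have : Continuous fun t : ℝ => u - (t * Real.sign lam) • y := by fun_prop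
    have h := (this.tendsto 0).mono_left (nhdsWithin_le_nhds (s := Set.Ioi 0))
    simpa using h
  refine mem_closure_of_tendsto ((tendsto_rescale (one_div_ne_zero hlam) huM.1).1.comp hline) ?_
  filter_upwards [hline.eventually (tendsto_rescale_realSpaceForm hlam huM), self_mem_nhdsWithin]
    with t ht ht0
  refine ⟨ht.2, fun hmem => ?_⟩
  have h1 := hy.2 _ hmem
  simp only [Function.comp_apply] at h1
  set z := u - (t * Real.sign lam) • y with hz
  have hzy : form lam z y = -(t * Real.sign lam * |lam|) := by
    rw [hz, form_sub_left, form_smul_left, huy, hy.1, zero_sub]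
  rw [form_smul_left, hzy] at h1
  have h2 : Real.sign lam * Real.sign lam = 1 := sign_mul_sign hlam
  have h3 : 0 < |lam| := abs_pos.2 hlam
  have ht0' : (0 : ℝ) < t := ht0
  have h4 : 0 < (√(form lam z z / (1 / lam)))⁻¹ * (t * |lam|) := mul_pos ht.1 (mul_pos ht0' h3)
  have h5 : Real.sign lam * ((√(form lam z z / (1 / lam)))⁻¹ * -(t * Real.sign lam * |lam|)) =
      -((√(form lam z z / (1 / lam)))⁻¹ * (t * |lam|)) := by
    linear_combination -(√(form lam z z / (1 / lam)))⁻¹ * (t * |lam|) * h2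
  linarith

/-- The roles are exchanged: moving y in the direction −u violates the condition that u imposes on
K*. -/
theorem mem_bd_dual_of_form_eq_zero (hlam : lam ≠ 0) (hK : IsConvexBody lam K) (hu : u ∈ K)
    (hy : y ∈ dualBody lam K) (huy : form lam u y = 0) :
    y ∈ bd (dualSpaceForm d lam) (dualBody lam K) := by
  have huM := hK.subset hu
  have hy' := (mem_dualBody_iff hlam).1 hy
  refine ⟨⟨mem_dualSpaceForm_iff.2 hy'.1, subset_closure hy⟩, ?_⟩
  have hline : Tendsto (fun t : ℝ => y - t • u) (𝓝[>] 0) (𝓝 y) := by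
    have : Continuous fun t : ℝ => y - t • u := by fun_prop
    have h := (this.tendsto 0).mono_left (nhdsWithin_le_nhds (s := Set.Ioi 0))
    simpa using h
  have hresc := tendsto_rescale (abs_ne_zero.2 hlam) hy'.1
  refine mem_closure_of_tendsto (hresc.1.comp hline) ?_
  filter_upwards [hline.eventually hresc.2, self_mem_nhdsWithin] with t ht ht0
  refine ⟨mem_dualSpaceForm_iff.2 ht.2, fun hmem => ?_⟩
  have h1 := ((mem_dualBody_iff hlam).1 hmem).2 u hu
  simp only [Function.comp_apply] at h1
  set z := y - t • u with hz
  have hzy : form lam u z = -(t * (1 / lam)) := by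
    rw [hz, form_sub_right, form_smul_right, huy, huM.1, zero_sub]
  rw [form_smul_right, hzy] at h1
  have ht0' : (0 : ℝ) < t := ht0
  have h2 : Real.sign lam * (1 / lam) = |lam|⁻¹ := by
    rw [mul_one_div, div_eq_iff hlam]
    rw [mul_comm, eq_mul_inv_iff_mul_eq₀ (abs_ne_zero.2 hlam), sign_mul_abs hlam]
  have h4 : 0 < (√(form lam z z / |lam|))⁻¹ * (t * |lam|⁻¹) :=
    mul_pos ht.1 (mul_pos ht0' (inv_pos.2 (abs_pos.2 hlam)))
  have h5 : Real.sign lam * ((√(form lam z z / |lam|))⁻¹ * -(t * (1 / lam))) =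
      -((√(form lam z z / |lam|))⁻¹ * (t * |lam|⁻¹)) := by
    linear_combination -(√(form lam z z / |lam|))⁻¹ * t * h2
  linarith

/-- `y` is a normal of `K` at `u`, scaled to the dual space form, and the second fundamental form
of the boundary of `K` at `u` is positive definite. -/
structure IsStrictContact (lam : ℝ) (K : Set (Ambient d)) (u y : Ambient d)
    (φ : EuclideanSpace ℝ (Fin (d - 1)) → Ambient d) : Prop where
  mem : u ∈ K
  dual : y ∈ dualBody lam K
  orth : form lam u y = 0
  param : IsC2Parametrization (bd (realSpaceForm d lam) K) u φ
  pos : ∀ v, v ≠ 0 → 0 < Real.sign lam * form lam y (fderiv ℝ (fderiv ℝ φ) 0 v v)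

theorem IsC2Parametrization.form_fderiv_left
    (h : IsC2Parametrization (bd (realSpaceForm d lam) K) u φ) (v) :
    form lam (fderiv ℝ φ 0 v) u = 0 := by
  have := form_fderiv_self_eq_zero (lam := lam) (h.contDiffAt.differentiableAt (by simp))
    (h.eventually_mem.mono fun p hp => hp.1.1.1) v
  rwa [h.1] at this

theorem IsC2Parametrization.form_fderiv_right (hlam : lam ≠ 0) (hK : IsConvexBody lam K)
    (h : IsC2Parametrization (bd (realSpaceForm d lam) K) u φ) (hy : y ∈ dualBody lam K)
    (huy : form lam u y = 0) (v) : form lam (fderiv ℝ φ 0 v) y = 0 :=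
  form_fderiv_eq_zero_of_nonneg (h.contDiffAt.differentiableAt (by simp))
    (c := Real.sign lam) (fun h0 => by simpa [h0] using sign_mul_sign hlam)
    (h.eventually_mem.mono fun p hp => ((mem_dualBody_iff hlam).1 hy).2 _ (bd_subset hK hp))
    (by rw [h.1, huy]) v

/-- The boundary of `K` separates quadratically from the tangent hyperplane. -/
theorem IsStrictContact.growth (hlam : lam ≠ 0) (hK : IsConvexBody lam K)
    (h : IsStrictContact lam K u y φ) : ∃ c > 0, ∀ᶠ x in 𝓝[bd (realSpaceForm d lam) K] u,
      c * ‖x - u‖ ^ 2 ≤ Real.sign lam * form lam x y := by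
  obtain ⟨h1, h2⟩ := hasFDerivAt_clm_comp_fderiv h.param.contDiffAt
    (Real.sign lam • formL d lam y)
  obtain ⟨c, hc, hgr⟩ := exists_quadratic_growth h1 h2 (by
    ext v
    simp [formL_apply, form_comm y, h.param.form_fderiv_right hlam hK h.dual h.orth])
    (fun v hv => by simpa [formL_apply] using h.pos v hv)
  -- Differentiability gives ‖φ(p) − u‖ ≤ L‖p‖, which turns growth in the parameter into growth in
  -- the ambient distance.
  have hO := (h.param.contDiffAt.differentiableAt (by simp)).hasFDerivAt.isBigO_sub
  obtain ⟨L, hL, hbound⟩ := hO.exists_pos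
  obtain ⟨τ, hτ, hτ'⟩ := h.param.exists_inverse
  refine ⟨c / L ^ 2, by positivity, ?_⟩
  filter_upwards [hτ', hτ.eventually hgr, hτ.eventually hbound.bound] with x hx hx1 hx2
  simp only [hx, h.param.1, sub_zero, smul_apply, formL_apply, form_comm y, h.orth,
    smul_eq_mul, mul_zero, zero_add] at hx1 hx2
  refine le_trans ?_ hx1
  calc c / L ^ 2 * ‖x - u‖ ^ 2 ≤ c / L ^ 2 * (L * ‖τ x‖) ^ 2 := by gcongr
    _ = c * ‖τ x‖ ^ 2 := by field_simp

/-- Quadratic separation makes the second fundamental form positive definite, whatever the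
parametrization. -/
theorem IsStrictContact.of_growth (hu : u ∈ K)
    (hy : y ∈ dualBody lam K) (huy : form lam u y = 0)
    (hφ : IsC2Parametrization (bd (realSpaceForm d lam) K) u φ)
    (hgr : ∃ c > 0, ∀ᶠ x in 𝓝[bd (realSpaceForm d lam) K] u,
      c * ‖x - u‖ ^ 2 ≤ Real.sign lam * form lam x y) : IsStrictContact lam K u y φ := by
  refine ⟨hu, hy, huy, hφ, fun v hv => ?_⟩
  obtain ⟨c, hc, hgr⟩ := hgr
  -- Injectivity of the differential gives the opposite bound ‖q‖ ≤ L‖φ(q) − u‖ near 0.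
  have hO := ((hφ.contDiffAt.differentiableAt (by simp)).hasFDerivAt.isTheta_sub
    (LinearMap.isClosedEmbedding_of_injective (f := (fderiv ℝ φ 0).toLinearMap)
      (LinearMap.ker_eq_bot.2 hφ.eventually_injective.self_of_nhds)).isInducing).2
  obtain ⟨L, hL, hbound⟩ := hO.exists_pos
  have htend : Tendsto φ (𝓝 0) (𝓝[bd (realSpaceForm d lam) K] u) := by
    refine tendsto_nhdsWithin_iff.2 ⟨?_, hφ.eventually_mem⟩
    have := hφ.contDiffAt.continuousAt.tendsto
    rwa [hφ.1] at this
  obtain ⟨h1, h2⟩ := hasFDerivAt_clm_comp_fderiv hφ.contDiffAt (Real.sign lam • formL d lam y)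
  have h1' : ∀ᶠ q in 𝓝 (0 : EuclideanSpace ℝ (Fin (d - 1))), HasFDerivAt
      (fun q => (Real.sign lam • formL d lam y) (φ q) - (c / L ^ 2) * ‖q‖ ^ 2)
      ((Real.sign lam • formL d lam y).comp (fderiv ℝ φ q) - (c / L ^ 2) • (2 • innerSL ℝ q)) q := by
    filter_upwards [h1] with q hq
    exact hq.sub ((hasStrictFDerivAt_norm_sq q).hasFDerivAt.const_mul _)
  have h2' := h2.sub (((innerSL ℝ (E := EuclideanSpace ℝ (Fin (d - 1)))).hasFDerivAt
    (x := 0)).const_smul (2 : ℕ) |>.const_smul (c / L ^ 2))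
  -- By the growth bound the pairing still has a minimum after (c/L²)‖q‖² is subtracted, so its
  -- second derivative dominates that of the subtracted term.
  have hmin : IsLocalMin
      (fun q => (Real.sign lam • formL d lam y) (φ q) - (c / L ^ 2) * ‖q‖ ^ 2) 0 := by
    filter_upwards [htend.eventually hgr, hbound.bound] with q hq1 hq2
    simp only [hφ.1, sub_zero, smul_apply, formL_apply, form_comm y, huy, smul_eq_mul,
      mul_zero, norm_zero] at hq1 hq2 ⊢
    have : c / L ^ 2 * ‖q‖ ^ 2 ≤ c * ‖φ q - u‖ ^ 2 :=
      calc c / L ^ 2 * ‖q‖ ^ 2 ≤ c / L ^ 2 * (L * ‖φ q - u‖) ^ 2 := by gcongr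
        _ = c * ‖φ q - u‖ ^ 2 := by field_simp
    simp only [ne_eq, OfNat.ofNat_ne_zero, not_false_eq_true, zero_pow, mul_zero]
    linarith
  have h3 := second_deriv_nonneg_of_isLocalMin h1' h2' hmin v
  have h4 : 0 < c / L ^ 2 * (2 * ‖v‖ ^ 2) := by
    have := norm_pos_iff.2 hv
    positivity
  have h5 : c / L ^ 2 * (2 * ‖v‖ ^ 2) ≤
      Real.sign lam * form lam y (fderiv ℝ (fderiv ℝ φ) 0 v v) := by
    have h6 : innerSL ℝ v v = ‖v‖ ^ 2 := real_inner_self_eq_norm_sq v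
    simpa [formL_apply, h6] using h3
  linarith

end Boundary

/-! ### Uniqueness and continuity of the contact between K and K* -/

section Contact

variable {d : ℕ} {lam : ℝ} {K : Set (Ambient d)} {u y : Ambient d}
  {φ : EuclideanSpace ℝ (Fin (d - 1)) → Ambient d}

theorem sign_ne_zero (hlam : lam ≠ 0) : Real.sign lam ≠ 0 := fun h => by
  simpa [h] using sign_mul_sign hlam

/-- The normal line of a hypersurface is one-dimensional. -/
theorem exists_eq_smul_of_orthogonal (hlam : lam ≠ 0) (hd : 2 ≤ d)
    {X : EuclideanSpace ℝ (Fin (d - 1)) →L[ℝ] Ambient d} (hX : Function.Injective X)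
    (hu : u ∈ realSpaceForm d lam) (hXu : ∀ v, form lam (X v) u = 0)
    (hy : form lam y y ≠ 0) (huy : form lam u y = 0) (hXy : ∀ v, form lam (X v) y = 0)
    {z : Ambient d} (huz : form lam u z = 0) (hXz : ∀ v, form lam (X v) z = 0) :
    ∃ b : ℝ, z = b • y := by
  have huu := form_self_ne_zero hlam hu
  obtain ⟨p, a, b, h⟩ := exists_decomposition hd hX huu hy huy hXu hXy z
  have ha : a = 0 := by
    have := congrArg (form lam u) h
    rw [huz, form_add_right, form_add_right, form_smul_right, form_smul_right, huy,
      form_comm u (X p), hXu] at this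
    simpa [huu] using this.symm
  subst ha
  refine ⟨b, ?_⟩
  -- The tangential part X p is orthogonal to itself, and tangent spaces of the real space form are
  -- definite.
  have h0 : form lam (X p) (X p) = 0 := by
    have := congrArg (form lam (X p)) h
    rw [hXz, form_add_right, form_add_right, form_smul_right, form_smul_right, hXy, hXu] at this
    simpa using this.symm
  have hXp : X p = 0 := by
    by_contra hne
    exact absurd (form_self_pos hlam hu (hXu p) hne) (by simp [h0])
  rw [h, hXp]
  simp

theorem IsC2Parametrization.tendsto {Γ : Set (Ambient d)} (h : IsC2Parametrization Γ u φ) :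
    Tendsto φ (𝓝 0) (𝓝[Γ] u) := by
  refine tendsto_nhdsWithin_iff.2 ⟨?_, h.eventually_mem⟩
  have := h.contDiffAt.continuousAt.tendsto
  rwa [h.1] at this

/-- As d − 1 ≥ 1, an injective differential is nonzero. This rules out that the boundary degenerates
to a point near u. -/
theorem IsC2Parametrization.not_eventually_const (hd : 2 ≤ d) {Γ : Set (Ambient d)}
    (h : IsC2Parametrization Γ u φ) : ¬ ∀ᶠ p in 𝓝 0, φ p = u := fun hc => by
  have h0 : fderiv ℝ φ 0 = 0 := by
    have : φ =ᶠ[𝓝 0] fun _ => u := hc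
    rw [this.fderiv_eq]
    simp
  have hi := h.eventually_injective.self_of_nhds
  rw [h0] at hi
  have := @hi (EuclideanSpace.single ⟨0, by omega⟩ 1) 0 (by simp)
  simpa using congrArg (fun w : EuclideanSpace ℝ (Fin (d - 1)) => w ⟨0, by omega⟩) this

/-- The boundary of `K` is not contained in the tangent hyperplane. -/
theorem IsStrictContact.exists_form_ne_zero (hlam : lam ≠ 0) (hd : 2 ≤ d) (hK : IsConvexBody lam K)
    (h : IsStrictContact lam K u y φ) : ∃ z ∈ bd (realSpaceForm d lam) K, form lam z y ≠ 0 := by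
  by_contra! hcon
  obtain ⟨c, hc, hgr⟩ := h.growth hlam hK
  refine h.param.not_eventually_const hd ?_
  filter_upwards [h.param.tendsto.eventually hgr, h.param.eventually_mem] with p hp hpm
  rw [hcon _ hpm, mul_zero] at hp
  have h1 : ‖φ p - u‖ ^ 2 ≤ 0 := by
    by_contra! hlt
    exact absurd hp (not_le.2 (mul_pos hc hlt))
  have h2 : ‖φ p - u‖ = 0 := by
    have := sq_nonneg ‖φ p - u‖
    exact pow_eq_zero_iff two_ne_zero |>.1 (le_antisymm h1 this)
  exact sub_eq_zero.1 (norm_eq_zero.1 h2)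

/-- The segment from u to x lies in K and in the hyperplane orthogonal to y, hence in bd K, where
quadratic growth forces it to stay at u near its start. So x is a multiple of u, and the quadric
leaves only x = ±u. -/
theorem IsStrictContact.eq_of_form_eq_zero_of_ne_neg (hlam : lam ≠ 0) (hK : IsConvexBody lam K)
    (h : IsStrictContact lam K u y φ) {x : Ambient d} (hx : x ∈ K) (hxy : form lam x y = 0)
    (hne : x ≠ -u) : x = u := by
  have huM := hK.subset h.mem
  obtain ⟨c, hc, hgr⟩ := h.growth hlam hK
  set z : ℝ → Ambient d := fun t => (1 - t) • u + t • x with hz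
  have hline : Tendsto z (𝓝[>] 0) (𝓝 u) := by
    have : Continuous z := by fun_prop
    have h := (this.tendsto 0).mono_left (nhdsWithin_le_nhds (s := Set.Ioi 0))
    simpa [hz] using h
  set r : ℝ → ℝ := fun t => (√(form lam (z t) (z t) / (1 / lam)))⁻¹ with hr
  have hzy : ∀ t, form lam (z t) y = 0 := fun t => by
    simp only [hz, form_add_left, form_smul_left, h.orth, hxy, mul_zero, add_zero]
  have hlim : Tendsto (fun t => r t • z t) (𝓝[>] 0) (𝓝 u) :=
    (tendsto_rescale (one_div_ne_zero hlam) huM.1).1.comp hline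
  have hlt : ∀ᶠ t : ℝ in 𝓝[>] 0, t < 1 :=
    (gt_mem_nhds one_pos).filter_mono nhdsWithin_le_nhds
  have hbd : ∀ᶠ t in 𝓝[>] 0, 0 < r t ∧ r t • z t ∈ bd (realSpaceForm d lam) K := by
    filter_upwards [hline.eventually (tendsto_rescale_realSpaceForm hlam huM), self_mem_nhdsWithin,
      hlt] with t ht ht0 ht1
    have ht0' : (0 : ℝ) < t := ht0
    refine ⟨ht.1, mem_bd_of_form_eq_zero hlam hK ?_ h.dual (by rw [form_smul_left, hzy, mul_zero])⟩
    refine hK.convex u h.mem x hx hne ⟨ht.2, r t * (1 - t), r t * t,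
      mul_nonneg ht.1.le (by linarith), mul_nonneg ht.1.le ht0'.le, ?_⟩
    simp only [hz, smul_add, smul_smul]
  have hlim' : Tendsto (fun t => r t • z t) (𝓝[>] 0) (𝓝[bd (realSpaceForm d lam) K] u) :=
    tendsto_nhdsWithin_iff.2 ⟨hlim, hbd.mono fun t ht => ht.2⟩
  obtain ⟨t, ht1, ht2, ht0⟩ :=
    ((hlim'.eventually hgr).and (hbd.and self_mem_nhdsWithin)).exists
  have ht0' : (0 : ℝ) < t := ht0
  rw [form_smul_left, hzy, mul_zero, mul_zero] at ht1
  have h1 : r t • z t = u := by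
    have h1 : ‖r t • z t - u‖ ^ 2 ≤ 0 := by
      by_contra! hlt
      exact absurd ht1 (not_le.2 (mul_pos hc hlt))
    have h2 : ‖r t • z t - u‖ = 0 :=
      pow_eq_zero_iff two_ne_zero |>.1 (le_antisymm h1 (sq_nonneg _))
    exact sub_eq_zero.1 (norm_eq_zero.1 h2)
  have hx' : x = (((r t)⁻¹ - (1 - t)) / t) • u := by
    have hrt := ht2.1.ne'
    have h3 : z t = (r t)⁻¹ • u := by rw [← h1, smul_smul, inv_mul_cancel₀ hrt, one_smul]
    have h4 : t • x = ((r t)⁻¹ - (1 - t)) • u := by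
      rw [sub_smul, ← h3]
      simp [hz]
    rw [div_eq_inv_mul, mul_smul, ← h4, smul_smul, inv_mul_cancel₀ ht0'.ne', one_smul]
  set k := ((r t)⁻¹ - (1 - t)) / t
  have hk : k * k = 1 := by
    have h5 := (hK.subset hx).1
    rw [hx', form_smul_left, form_smul_right, huM.1, ← mul_assoc] at h5
    have := one_div_ne_zero hlam
    exact mul_right_cancel₀ this (by rw [h5, one_mul])
  rcases mul_self_eq_one_iff.1 hk with h6 | h6
  · rw [hx', h6, one_smul]
  · exact absurd (by rw [hx', h6, neg_one_smul]) hne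

/-- A supporting hyperplane meets `K` in one point only. -/
theorem IsStrictContact.eq_of_form_eq_zero (hlam : lam ≠ 0) (hd : 2 ≤ d) (hK : IsConvexBody lam K)
    (hS : ∀ u ∈ bd (realSpaceForm d lam) K, ∃ y φ, IsStrictContact lam K u y φ)
    (h : IsStrictContact lam K u y φ) {x : Ambient d} (hx : x ∈ K) (hxy : form lam x y = 0) :
    x = u := by
  by_cases hne : x = -u
  -- If −u were in K, take a boundary point z off the hyperplane, with normal w. Both u and −u
  -- satisfy the inequality of w, so u is orthogonal to w. The preceding lemma at z then gives u =
  -- z, which lies on the hyperplane after all.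
  · exfalso
    obtain ⟨z, hz, hzy⟩ := h.exists_form_ne_zero hlam hd hK
    obtain ⟨w, ψ, hw⟩ := hS z hz
    have hpos := ((mem_dualBody_iff hlam).1 hw.dual).2
    have h1 := hpos u h.mem
    have h2 := hpos x hx
    rw [hne, form_neg_left] at h2
    have huw : form lam u w = 0 := by
      have : Real.sign lam * form lam u w = 0 := by linarith
      simpa [sign_ne_zero hlam] using this
    have hu : u = z := by
      refine hw.eq_of_form_eq_zero_of_ne_neg hlam hK h.mem huw fun hu => hzy ?_
      have := h.orth
      rw [hu, form_neg_left] at this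
      linarith
    exact hzy (hu ▸ h.orth)
  · exact h.eq_of_form_eq_zero_of_ne_neg hlam hK hx hxy hne

/-- The quadric gives b = ±1, and a point of K off the hyperplane decides the sign. -/
theorem eq_of_smul_eq_of_dual (hlam : lam ≠ 0) {z x : Ambient d} (hy : y ∈ dualBody lam K)
    (hz : z ∈ dualBody lam K) {b : ℝ} (hb : z = b • y) (hx : x ∈ K) (hxy : form lam x y ≠ 0) :
    z = y := by
  rw [mem_dualBody_iff hlam] at hy hz
  have hbb : b * b = 1 := by
    have h5 := hz.1
    rw [hb, form_smul_left, form_smul_right, hy.1, ← mul_assoc] at h5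
    exact mul_right_cancel₀ (abs_ne_zero.2 hlam) (by rw [h5, one_mul])
  rcases mul_self_eq_one_iff.1 hbb with h6 | h6
  · rw [hb, h6, one_smul]
  · exfalso
    have h1 := hy.2 x hx
    have h2 := hz.2 x hx
    rw [hb, h6, form_smul_right] at h2
    have : Real.sign lam * form lam x y = 0 := by linarith
    simp [sign_ne_zero hlam, hxy] at this

/-- There is only one point of the dual body that is orthogonal to a boundary point of `K`. -/
theorem IsStrictContact.dual_eq_of_form_eq_zero (hlam : lam ≠ 0) (hd : 2 ≤ d)
    (hK : IsConvexBody lam K) (h : IsStrictContact lam K u y φ) {z : Ambient d}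
    (hz : z ∈ dualBody lam K) (huz : form lam u z = 0) : z = y := by
  obtain ⟨x, hx, hxy⟩ := h.exists_form_ne_zero hlam hd hK
  obtain ⟨b, hb⟩ := exists_eq_smul_of_orthogonal hlam hd h.param.eventually_injective.self_of_nhds
    (hK.subset h.mem) h.param.form_fderiv_left
    (by rw [((mem_dualBody_iff hlam).1 h.dual).1]; exact abs_ne_zero.2 hlam) h.orth
    (h.param.form_fderiv_right hlam hK h.dual h.orth) huz
    (h.param.form_fderiv_right hlam hK hz huz)
  exact eq_of_smul_eq_of_dual hlam h.dual hz hb (bd_subset hK hx) hxy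

/-- If all pairings with the compact set K were strict, they would stay strict for vectors near y,
and y would be interior to K*. -/
theorem exists_form_eq_zero_of_mem_bd_dual (hlam : lam ≠ 0) (hK : IsConvexBody lam K)
    (hy : y ∈ bd (dualSpaceForm d lam) (dualBody lam K)) : ∃ x ∈ K, form lam x y = 0 := by
  by_contra! hcon
  have hpos := ((mem_dualBody_iff hlam).1 (bd_dual_subset hlam hy)).2
  have hev : ∀ᶠ z in 𝓝 y, ∀ x ∈ K, 0 < Real.sign lam * form lam x z := by
    refine hK.isCompact.eventually_forall_of_forall_eventually fun x hx => ?_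
    have hc : Continuous fun w : Ambient d × Ambient d => Real.sign lam * form lam w.2 w.1 :=
      continuous_const.mul (continuous_form.comp (continuous_snd.prodMk continuous_fst))
    refine hc.continuousAt.eventually (lt_mem_nhds ?_)
    exact lt_of_le_of_ne (hpos x hx) (mul_ne_zero (sign_ne_zero hlam) (hcon x hx)).symm
  obtain ⟨z, hz1, hz2⟩ := (mem_closure_iff_frequently.1 hy.2).and_eventually hev |>.exists
  exact hz1.2 ((mem_dualBody_iff hlam).2
    ⟨mem_dualSpaceForm_iff.1 hz1.1, fun x hx => (hz2 x hx).le⟩)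

/-- Near `y`, the boundary points of the dual body touch `K` at points of the parametrization. -/
theorem IsStrictContact.exists_contact_param (hlam : lam ≠ 0) (hd : 2 ≤ d)
    (hK : IsConvexBody lam K)
    (hS : ∀ u ∈ bd (realSpaceForm d lam) K, ∃ y φ, IsStrictContact lam K u y φ)
    (h : IsStrictContact lam K u y φ) :
    ∃ π : Ambient d → EuclideanSpace ℝ (Fin (d - 1)),
      Tendsto π (𝓝[bd (dualSpaceForm d lam) (dualBody lam K)] y) (𝓝 0) ∧
      ∀ᶠ z in 𝓝[bd (dualSpaceForm d lam) (dualBody lam K)] y, form lam (φ (π z)) z = 0 := by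
  have hex : ∀ z, ∃ x, z ∈ bd (dualSpaceForm d lam) (dualBody lam K) → x ∈ K ∧ form lam x z = 0 := by
    intro z
    by_cases hz : z ∈ bd (dualSpaceForm d lam) (dualBody lam K)
    · obtain ⟨x, hx⟩ := exists_form_eq_zero_of_mem_bd_dual hlam hK hz
      exact ⟨x, fun _ => hx⟩
    · exact ⟨0, fun h => absurd h hz⟩
  choose c hc using hex
  have hpos := ((mem_dualBody_iff hlam).1 h.dual).2
  have hlim : Tendsto c (𝓝[bd (dualSpaceForm d lam) (dualBody lam K)] y)
      (𝓝[bd (realSpaceForm d lam) K] u) := by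
    refine tendsto_nhdsWithin_iff.2 ⟨?_, ?_⟩
    -- On the compact set K \ U the pairing with y is strict, because u is the only contact point.
    -- It stays strict for z near y, so contact points of such z lie in U.
    · refine (nhds_basis_opens u).tendsto_right_iff.2 fun U hU => ?_
      have hev : ∀ᶠ z in 𝓝 y, ∀ x ∈ K \ U, 0 < Real.sign lam * form lam x z := by
        refine (hK.isCompact.diff hU.2).eventually_forall_of_forall_eventually fun x hx => ?_
        have hc : Continuous fun w : Ambient d × Ambient d => Real.sign lam * form lam w.2 w.1 :=
          continuous_const.mul (continuous_form.comp (continuous_snd.prodMk continuous_fst))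
        refine hc.continuousAt.eventually (lt_mem_nhds ?_)
        refine lt_of_le_of_ne (hpos x hx.1) (mul_ne_zero (sign_ne_zero hlam) fun h0 => ?_).symm
        exact hx.2 (h.eq_of_form_eq_zero hlam hd hK hS hx.1 h0 ▸ hU.1)
      filter_upwards [mem_nhdsWithin_of_mem_nhds hev, self_mem_nhdsWithin] with z hz hzb
      by_contra hcU
      have := hz (c z) ⟨(hc z hzb).1, hcU⟩
      rw [(hc z hzb).2, mul_zero] at this
      exact lt_irrefl _ this
    · filter_upwards [self_mem_nhdsWithin] with z hz
      exact mem_bd_of_form_eq_zero hlam hK (hc z hz).1 (bd_dual_subset hlam hz) (hc z hz).2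
  obtain ⟨τ, hτ, hτ'⟩ := h.param.exists_inverse
  refine ⟨fun z => τ (c z), hτ.comp hlim, ?_⟩
  filter_upwards [hlim.eventually hτ', self_mem_nhdsWithin] with z hz hzb
  rw [hz]
  exact (hc z hzb).2

end Contact

/-! ### Parametrizations from a local left inverse -/

section LeftInverse

variable {d : ℕ} {lam : ℝ} {K : Set (Ambient d)} {u y : Ambient d}
  {φ : EuclideanSpace ℝ (Fin (d - 1)) → Ambient d}

/-- A `C²` map with a `C¹` local left inverse parametrizes a set if, locally, it takes its values in
the set and inverts the left inverse on the set. -/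
theorem isC2Parametrization_of_leftInverse {Γ : Set (Ambient d)}
    {ψ : EuclideanSpace ℝ (Fin (d - 1)) → Ambient d}
    {θ : Ambient d → EuclideanSpace ℝ (Fin (d - 1))} (h0 : ψ 0 = y) (hψ : ContDiffAt ℝ 2 ψ 0)
    (hθ : ContDiffAt ℝ 1 θ y) (hl : ∀ᶠ w in 𝓝 0, θ (ψ w) = w) (hΓ : ∀ᶠ w in 𝓝 0, ψ w ∈ Γ)
    (hr : ∀ᶠ z in 𝓝[Γ] y, ψ (θ z) = z) : IsC2Parametrization Γ y ψ := by
  have hU := (hθ.eventually (by simp)).and (eventually_nhdsWithin_iff.1 hr)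
  obtain ⟨U, hU, hUo, hyU⟩ := eventually_nhds_iff.1 hU
  have hcont : Tendsto ψ (𝓝 0) (𝓝 y) := by simpa [h0] using hψ.continuousAt.tendsto
  have hW := (hψ.eventually (by simp)).and (hl.and (hΓ.and
    (hcont.eventually (hUo.mem_nhds hyU))))
  obtain ⟨W, hW, hWo, h0W⟩ := eventually_nhds_iff.1 hW
  have hθc : ContinuousOn θ U := fun z hz => (hU z hz).1.continuousAt.continuousWithinAt
  have hψc : ContinuousOn ψ W := fun z hz => (hW z hz).1.continuousAt.continuousWithinAt
  refine ⟨h0, W, hWo, h0W, fun w hw => (hW w hw).1.contDiffWithinAt, fun w hw => ?_, ?_,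
    U ∩ θ ⁻¹' W, hθc.isOpen_inter_preimage hUo hWo, ?_⟩
  · obtain ⟨h1, h2, h3, h4⟩ := hW w hw
    have h5 := ((hU _ h4).1.differentiableAt (by simp)).hasFDerivAt.comp w
      (h1.differentiableAt (by simp)).hasFDerivAt
    have h6 : HasFDerivAt (θ ∘ ψ) (ContinuousLinearMap.id ℝ _) w := by
      refine (hasFDerivAt_id w).congr_of_eventuallyEq ?_
      filter_upwards [hWo.mem_nhds hw] with w' hw' using (hW w' hw').2.1
    have h7 := h5.unique h6
    exact Function.LeftInverse.injective (g := fderiv ℝ θ (ψ w)) fun v => DFunLike.congr_fun h7 v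
  -- θ is continuous only on U, so ψ is corestricted to U before the left inverse is used to obtain
  -- an embedding.
  · let f : W → U := fun w => ⟨ψ w, (hW w w.2).2.2.2⟩
    have hf : Continuous f := by
      refine Continuous.subtype_mk ?_ _
      exact continuousOn_iff_continuous_domRestrict.1 hψc
    have hg : Continuous fun z : U => θ z := continuousOn_iff_continuous_domRestrict.1 hθc
    have hcomp : (fun z : U => θ z) ∘ f = Subtype.val := by
      funext w
      exact (hW w w.2).2.1
    have he : IsEmbedding f := IsEmbedding.of_comp hf hg (by rw [hcomp]; exact .subtypeVal)
    exact IsEmbedding.subtypeVal.comp he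
  · ext z
    constructor
    · rintro ⟨w, hw, rfl⟩
      obtain ⟨_, h2, h3, h4⟩ := hW w hw
      exact ⟨h3, h4, by rw [Set.mem_preimage, h2]; exact hw⟩
    · rintro ⟨hz, hzU, hzW⟩
      exact ⟨θ z, hzW, (hU z hzU).2 hz⟩

end LeftInverse

/-! ### Normal vectors as functions of their tangential component -/

section ContactVector

variable {d : ℕ} {lam : ℝ} {K : Set (Ambient d)} {u y : Ambient d}
  {φ : EuclideanSpace ℝ (Fin (d - 1)) → Ambient d}

/-- The coefficient `a` for which `y + dφ₀(w) + a u` is orthogonal to `φ p`. -/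
def contactCoeff (lam : ℝ) (u y : Ambient d) (φ : EuclideanSpace ℝ (Fin (d - 1)) → Ambient d)
    (z : EuclideanSpace ℝ (Fin (d - 1)) × EuclideanSpace ℝ (Fin (d - 1))) : ℝ :=
  -(formL d lam (y + fderiv ℝ φ 0 z.1) (φ z.2)) * (formL d lam u (φ z.2))⁻¹

/-- The vector `y + dφ₀(w) + a u` that is orthogonal to `φ p`. -/
def contactVector (lam : ℝ) (u y : Ambient d) (φ : EuclideanSpace ℝ (Fin (d - 1)) → Ambient d)
    (z : EuclideanSpace ℝ (Fin (d - 1)) × EuclideanSpace ℝ (Fin (d - 1))) : Ambient d :=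
  y + fderiv ℝ φ 0 z.1 + contactCoeff lam u y φ z • u

/-- The functional that vanishes if `contactVector` is normal to the parametrized hypersurface. -/
def contactDiff (lam : ℝ) (u y : Ambient d) (φ : EuclideanSpace ℝ (Fin (d - 1)) → Ambient d)
    (z : EuclideanSpace ℝ (Fin (d - 1)) × EuclideanSpace ℝ (Fin (d - 1))) :
    EuclideanSpace ℝ (Fin (d - 1)) →L[ℝ] ℝ :=
  (formL d lam (contactVector lam u y φ z)).comp (fderiv ℝ φ z.2)

theorem form_contactVector {z : EuclideanSpace ℝ (Fin (d - 1)) × EuclideanSpace ℝ (Fin (d - 1))}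
    (hz : form lam u (φ z.2) ≠ 0) : form lam (contactVector lam u y φ z) (φ z.2) = 0 := by
  rw [contactVector, form_add_left, form_smul_left, contactCoeff, formL_apply, formL_apply,
    mul_assoc, inv_mul_cancel₀ hz]
  ring

theorem contDiffAt_contactCoeff (hφ : ContDiffAt ℝ 2 φ 0) (h0 : φ 0 = u)
    (hu : form lam u u ≠ 0) :
    ContDiffAt ℝ 1 (contactCoeff lam u y φ) 0 := by
  have h1 : ContDiffAt ℝ 1 (fun z : EuclideanSpace ℝ (Fin (d - 1)) × EuclideanSpace ℝ (Fin (d - 1)) =>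
      φ z.2) 0 := 
    ContDiffAt.comp (g := φ) (0 : EuclideanSpace ℝ (Fin (d - 1)) × EuclideanSpace ℝ (Fin (d - 1)))
      (hφ.of_le (by norm_num)) contDiffAt_snd
  have h2 : ContDiffAt ℝ 1 (fun z : EuclideanSpace ℝ (Fin (d - 1)) × EuclideanSpace ℝ (Fin (d - 1)) =>
      formL d lam (y + fderiv ℝ φ 0 z.1)) 0 := by fun_prop
  have h3 := h2.clm_apply h1
  have h4 := (contDiffAt_const (c := formL d lam u)).clm_apply h1
  exact h3.neg.mul (h4.inv (by simpa [h0, formL_apply] using hu))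

theorem contDiffAt_contactVector (hφ : ContDiffAt ℝ 2 φ 0) (h0 : φ 0 = u)
    (hu : form lam u u ≠ 0) :
    ContDiffAt ℝ 1 (contactVector lam u y φ) 0 := by
  have h1 := contDiffAt_contactCoeff (lam := lam) (y := y) hφ h0 hu
  have h2 : ContDiffAt ℝ 1 (fun z : EuclideanSpace ℝ (Fin (d - 1)) × EuclideanSpace ℝ (Fin (d - 1)) =>
      y + fderiv ℝ φ 0 z.1) 0 := by fun_prop
  exact h2.add (h1.smul contDiffAt_const)

theorem contDiffAt_contactDiff (hφ : ContDiffAt ℝ 2 φ 0) (h0 : φ 0 = u)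
    (hu : form lam u u ≠ 0) :
    ContDiffAt ℝ 1 (contactDiff lam u y φ) 0 := by
  have h1 : ContDiffAt ℝ 1 (fun z => formL d lam (contactVector lam u y φ z)) 0 :=
    (formL d lam).contDiff.contDiffAt.comp 0 (contDiffAt_contactVector hφ h0 hu)
  have h2 : ContDiffAt ℝ 1 (fun z : EuclideanSpace ℝ (Fin (d - 1)) × EuclideanSpace ℝ (Fin (d - 1)) =>
      fderiv ℝ φ z.2) 0 :=
    ContDiffAt.comp (g := fderiv ℝ φ) (0 : EuclideanSpace ℝ (Fin (d - 1)) × EuclideanSpace ℝ (Fin (d - 1)))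
      (hφ.fderiv_right (m := 1) (by norm_num)) contDiffAt_snd
  exact h1.clm_comp h2

theorem contactCoeff_zero (h0 : φ 0 = u) (huy : form lam u y = 0) :
    contactCoeff lam u y φ 0 = 0 := by
  simp [contactCoeff, h0, formL_apply, form_comm y, huy]

theorem contactVector_zero (h0 : φ 0 = u) (huy : form lam u y = 0) :
    contactVector lam u y φ 0 = y := by
  simp [contactVector, contactCoeff_zero h0 huy]

/-- In the direction (0, p) the vector changes only by a multiple of u, which is orthogonal to the
tangent space; only the second derivative of φ contributes. -/
theorem fderiv_contactDiff (hφ : ContDiffAt ℝ 2 φ 0) (h0 : φ 0 = u) (hu : form lam u u ≠ 0)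
    (huy : form lam u y = 0) (hXu : ∀ v, form lam (fderiv ℝ φ 0 v) u = 0)
    (p v : EuclideanSpace ℝ (Fin (d - 1))) :
    fderiv ℝ (contactDiff lam u y φ) 0 (0, p) v = form lam y (fderiv ℝ (fderiv ℝ φ) 0 p v) := by
  have hα := ((contDiffAt_contactCoeff (y := y) hφ h0 hu).differentiableAt
    one_ne_zero).hasFDerivAt
  have h1 : HasFDerivAt (contactVector lam u y φ)
      ((fderiv ℝ φ 0).comp (.fst ℝ _ _) + (fderiv ℝ (contactCoeff lam u y φ) 0).smulRight u) 0 :=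
    (((fderiv ℝ φ 0).hasFDerivAt.comp _ hasFDerivAt_fst).const_add y).add (hα.smul_const u)
  have h2 := (formL d lam).hasFDerivAt.comp 0 h1
  have h3 : HasFDerivAt (fun z : EuclideanSpace ℝ (Fin (d - 1)) × EuclideanSpace ℝ (Fin (d - 1)) =>
      fderiv ℝ φ z.2) ((fderiv ℝ (fderiv ℝ φ) 0).comp (.snd ℝ _ _)) 0 :=
    HasFDerivAt.comp (g := fderiv ℝ φ) (0 : EuclideanSpace ℝ (Fin (d - 1)) × EuclideanSpace ℝ (Fin (d - 1)))
      hφ.hasFDerivAt_fderiv hasFDerivAt_snd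
  have h4 : HasFDerivAt (contactDiff lam u y φ) _ 0 := h2.clm_comp h3
  rw [h4.fderiv]
  simp [formL_apply, form_comm u, hXu, contactVector_zero h0 huy]

theorem contactDiff_zero (hlam : lam ≠ 0) (hK : IsConvexBody lam K)
    (h : IsStrictContact lam K u y φ) : contactDiff lam u y φ 0 = 0 := by
  ext v
  simp [contactDiff, contactVector_zero h.param.1 h.orth, formL_apply, form_comm y,
    h.param.form_fderiv_right hlam hK h.dual h.orth]

theorem IsStrictContact.eq_zero_of_second_eq_zero (h : IsStrictContact lam K u y φ)
    {p : EuclideanSpace ℝ (Fin (d - 1))}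
    (hp : form lam y (fderiv ℝ (fderiv ℝ φ) 0 p p) = 0) : p = 0 := by
  by_contra hne
  have := h.pos p hne
  rw [hp, mul_zero] at this
  exact lt_irrefl _ this

/-- The partial derivative in p is the second fundamental form in direction y, which is definite. -/
theorem IsStrictContact.isInvertible_contactDiff (hlam : lam ≠ 0) (hK : IsConvexBody lam K)
    (h : IsStrictContact lam K u y φ) :
    (fderiv ℝ (contactDiff lam u y φ) 0 ∘L .inr ℝ _ _).IsInvertible := by
  refine isInvertible_of_injective_dual ((injective_iff_map_eq_zero _).2 fun p hp => ?_)
  refine h.eq_zero_of_second_eq_zero ?_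
  rw [← fderiv_contactDiff h.param.contDiffAt h.param.1
    (form_self_ne_zero hlam (hK.subset h.mem)) h.orth h.param.form_fderiv_left p p]
  exact DFunLike.congr_fun hp p

/-- The contact point as a `C¹` function of the direction of the normal vector. -/
theorem IsStrictContact.exists_contact_function (hlam : lam ≠ 0) (hK : IsConvexBody lam K)
    (h : IsStrictContact lam K u y φ) :
    ∃ p : EuclideanSpace ℝ (Fin (d - 1)) → EuclideanSpace ℝ (Fin (d - 1)), p 0 = 0 ∧
      ContDiffAt ℝ 1 p 0 ∧ (∀ᶠ w in 𝓝 0, contactDiff lam u y φ (w, p w) = 0) ∧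
      ∀ᶠ z in 𝓝 0, contactDiff lam u y φ z = 0 → p z.1 = z.2 := by
  have hG := contDiffAt_contactDiff (y := y) h.param.contDiffAt h.param.1
    (form_self_ne_zero hlam (hK.subset h.mem))
  have hinv := h.isInvertible_contactDiff hlam hK
  have h0 := contactDiff_zero hlam hK h
  refine ⟨hG.implicitFunction one_ne_zero hinv, hG.implicitFunction_apply_self one_ne_zero hinv,
    hG.contDiffAt_implicitFunction one_ne_zero hinv, ?_, ?_⟩
  · have := hG.eventually_apply_implicitFunction one_ne_zero hinv
    rwa [h0] at this
  · filter_upwards [hG.eventually_apply_eq_iff_implicitFunction one_ne_zero hinv] with z hz hz0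
    exact hz.1 (hz0.trans h0.symm)

/-- The normal vector is a `C²` function of its tangential component. -/
theorem contDiffAt_contactVector_two (hφ : ContDiffAt ℝ 2 φ 0) (h0 : φ 0 = u)
    (hu : form lam u u ≠ 0)
    {p : EuclideanSpace ℝ (Fin (d - 1)) → EuclideanSpace ℝ (Fin (d - 1))} (hp0 : p 0 = 0)
    (hp : ContDiffAt ℝ 1 p 0) (hpG : ∀ᶠ w in 𝓝 0, contactDiff lam u y φ (w, p w) = 0) :
    ContDiffAt ℝ 2 (fun w => contactVector lam u y φ (w, p w)) 0 := by
  have hpair : ContDiffAt ℝ 1 (fun w => (w, p w)) 0 := contDiffAt_id.prodMk hp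
  have hpair0 : ((0 : EuclideanSpace ℝ (Fin (d - 1))), p 0) = 0 := by rw [hp0]; rfl
  have hα : ContDiffAt ℝ 1 (fun w => contactCoeff lam u y φ (w, p w)) 0 :=
    ContDiffAt.comp (g := contactCoeff lam u y φ) (0 : EuclideanSpace ℝ (Fin (d - 1)))
      (by rw [hpair0]; exact contDiffAt_contactCoeff hφ h0 hu) hpair
  have hφp : ContDiffAt ℝ 1 (fun w => φ (p w)) 0 :=
    ContDiffAt.comp (0 : EuclideanSpace ℝ (Fin (d - 1)))
      (by rw [hp0]; exact hφ.of_le (by norm_num)) hp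
  have hp_tend : Tendsto p (𝓝 0) (𝓝 0) := by simpa [hp0] using hp.continuousAt.tendsto
  have hb : ∀ᶠ w in 𝓝 0, form lam u (φ (p w)) ≠ 0 := by
    have hc : ContinuousAt (fun w => form lam u (φ (p w))) 0 :=
      (continuous_form_right u).continuousAt.comp hφp.continuousAt
    exact hc.eventually_ne (by simpa [hp0, h0] using hu)
  -- Envelope argument: when ⟨Y(w), φ(p(w))⟩ = 0 is differentiated, the term with the derivative of
  -- p drops out since Y(w) is normal at φ(p(w)). The remaining formula for the derivative of the
  -- coefficient contains only φ(p(w)), which is C¹.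
  have hα2 : ContDiffAt ℝ 2 (fun w => contactCoeff lam u y φ (w, p w)) 0 := by
    rw [show (2 : WithTop ℕ∞) = (1 : ℕ) + 1 by norm_num, contDiffAt_succ_iff_hasFDerivAt]
    refine ⟨fun w => -((formL d lam u (φ (p w)))⁻¹ •
      (formL d lam (φ (p w))).comp (fderiv ℝ φ 0)), ?_, ?_⟩
    · refine ⟨_, ?_, fun w hw => hw⟩
      have hα_d := hα.eventually (by simp)
      have hp_d := hp.eventually (by simp)
      have hφ_d := hp_tend.eventually hφ.eventually_hasFDerivAt_of_two
      change ∀ᶠ w in 𝓝 0, _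
      filter_upwards [hα_d, hp_d, hφ_d, hb, hb.eventually_nhds, hpG] with w h1 h2 h3 h4 h5 h6
      have e1 := (h1.differentiableAt one_ne_zero).hasFDerivAt
      have e2 := h3.comp w (h2.differentiableAt one_ne_zero).hasFDerivAt
      set a' := fderiv ℝ (fun w => contactCoeff lam u y φ (w, p w)) w
      have e3 : HasFDerivAt (fun w => contactVector lam u y φ (w, p w))
          (fderiv ℝ φ 0 + a'.smulRight u) w :=
        ((fderiv ℝ φ 0).hasFDerivAt.const_add y).add (e1.smul_const u)
      have e4 := (formL d lam).hasFDerivAt_of_bilinear e3 e2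
      have e5 : HasFDerivAt (fun w => formL d lam (contactVector lam u y φ (w, p w))
          ((φ ∘ p) w)) (0 : _ →L[ℝ] ℝ) w := by
        refine (hasFDerivAt_const (0 : ℝ) w).congr_of_eventuallyEq ?_
        filter_upwards [h5] with w' hw'
        exact form_contactVector (z := (w', p w')) hw'
      have e6 := e4.unique e5
      refine e1.congr_fderiv ?_
      ext v
      have e7 := DFunLike.congr_fun e6 v
      have e8 : formL d lam (contactVector lam u y φ (w, p w))
          (fderiv ℝ φ (p w) (fderiv ℝ p w v)) = 0 :=
        DFunLike.congr_fun h6 (fderiv ℝ p w v)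
      simp only [add_apply, ContinuousLinearMap.precompR_apply, ContinuousLinearMap.precompL_apply,
        ContinuousLinearMap.compL_apply, ContinuousLinearMap.comp_apply, e8, zero_add,
        ContinuousLinearMap.smulRight_apply, map_add, map_smul, smul_apply, formL_apply,
        Function.comp_apply, smul_eq_mul, zero_apply] at e7
      simp only [neg_apply, smul_apply, ContinuousLinearMap.comp_apply, formL_apply, smul_eq_mul,
        form_comm (φ (p w))]
      field_simp
      linarith
    · have h1 : ContDiffAt ℝ 1 (fun w => formL d lam u (φ (p w))) 0 :=
        (formL d lam u).contDiff.contDiffAt.comp _ hφp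
      have h2 : ContDiffAt ℝ 1 (fun w => formL d lam (φ (p w))) 0 :=
        (formL d lam).contDiff.contDiffAt.comp _ hφp
      exact ((h1.inv (hb.self_of_nhds)).smul (h2.clm_comp contDiffAt_const)).neg
  have h2 : ContDiffAt ℝ 2 (fun w : EuclideanSpace ℝ (Fin (d - 1)) => y + fderiv ℝ φ 0 w) 0 := by
    fun_prop
  exact h2.add (hα2.smul contDiffAt_const)

end ContactVector

/-! ### The boundary of the dual body is a C² hypersurface -/

section DualParametrization

variable {d : ℕ} {lam : ℝ} {K : Set (Ambient d)} {u y : Ambient d}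
  {φ : EuclideanSpace ℝ (Fin (d - 1)) → Ambient d}

/-- Rescaling to a quadric is smooth. -/
theorem contDiffAt_rescale {P : Type*} [NormedAddCommGroup P] [NormedSpace ℝ P]
    {Y : P → Ambient d} {p : P} (hY : ContDiffAt ℝ 2 Y p) {κ : ℝ} (hκ : κ ≠ 0)
    (h : form lam (Y p) (Y p) = κ) :
    ContDiffAt ℝ 2 (fun w => (√(form lam (Y w) (Y w) / κ))⁻¹ • Y w) p := by
  have h1 : ContDiffAt ℝ 2 (fun w => form lam (Y w) (Y w) / κ) p := by
    have : ContDiffAt ℝ 2 (fun w => formL d lam (Y w) (Y w)) p :=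
      ((formL d lam).contDiff.contDiffAt.comp p hY).clm_apply hY
    exact this.div_const κ
  have h2 : form lam (Y p) (Y p) / κ ≠ 0 := by rw [h, div_self hκ]; exact one_ne_zero
  refine ((h1.sqrt h2).inv ?_).smul hY
  rw [h, div_self hκ]
  simp

/-- A vector that is orthogonal to the hypersurface at a point near `u`, that lies in the dual space
form and that is near `y`, is a point of the boundary of the dual body. -/
theorem IsStrictContact.mem_bd_dual (hlam : lam ≠ 0) (hd : 2 ≤ d) (hK : IsConvexBody lam K)
    (hS : ∀ u ∈ bd (realSpaceForm d lam) K, ∃ y φ, IsStrictContact lam K u y φ)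
    {p : EuclideanSpace ℝ (Fin (d - 1))} (hpd : DifferentiableAt ℝ φ p)
    (hpi : Function.Injective (fderiv ℝ φ p))
    (hpb : ∀ᶠ q in 𝓝 p, φ q ∈ bd (realSpaceForm d lam) K) {z x : Ambient d}
    (hz : form lam z z = |lam|) (hz0 : form lam (φ p) z = 0)
    (hz1 : ∀ v, form lam (fderiv ℝ φ p v) z = 0) (hx : x ∈ K)
    (hxz : 0 < Real.sign lam * form lam x z) :
    z ∈ bd (dualSpaceForm d lam) (dualBody lam K) := by
  have hp := hpb.self_of_nhds
  obtain ⟨y', φ', h'⟩ := hS _ hp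
  have hy' := (mem_dualBody_iff hlam).1 h'.dual
  have hy1 : ∀ v, form lam (fderiv ℝ φ p v) y' = 0 :=
    form_fderiv_eq_zero_of_nonneg hpd (sign_ne_zero hlam)
      (hpb.mono fun q hq => hy'.2 _ (bd_subset hK hq)) h'.orth
  have hu1 : ∀ v, form lam (fderiv ℝ φ p v) (φ p) = 0 :=
    form_fderiv_self_eq_zero hpd (hpb.mono fun q hq => hq.1.1.1)
  obtain ⟨b, hb⟩ := exists_eq_smul_of_orthogonal hlam hd hpi (hK.subset h'.mem) hu1
    (by rw [hy'.1]; exact abs_ne_zero.2 hlam) h'.orth hy1 hz0 hz1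
  have hbb : b * b = 1 := by
    have h5 := hz
    rw [hb, form_smul_left, form_smul_right, hy'.1, ← mul_assoc] at h5
    exact mul_right_cancel₀ (abs_ne_zero.2 hlam) (by rw [h5, one_mul])
  -- The strict inequality at x excludes z = −y'.
  have hzy : z = y' := by
    rcases mul_self_eq_one_iff.1 hbb with h6 | h6
    · rw [hb, h6, one_smul]
    · exfalso
      have h1 := hy'.2 x hx
      rw [hb, h6, form_smul_right] at hxz
      linarith
  rw [hzy]
  exact mem_bd_dual_of_form_eq_zero hlam hK h'.mem h'.dual h'.orth

/-- The boundary of the dual body is a `C²`-smooth embedded hypersurface. -/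
theorem IsStrictContact.exists_dual_param (hlam : lam ≠ 0) (hd : 2 ≤ d) (hK : IsConvexBody lam K)
    (hS : ∀ u ∈ bd (realSpaceForm d lam) K, ∃ y φ, IsStrictContact lam K u y φ)
    (h : IsStrictContact lam K u y φ) :
    ∃ ψ, IsC2Parametrization (bd (dualSpaceForm d lam) (dualBody lam K)) y ψ := by
  have hφ := h.param.contDiffAt
  have hφ0 := h.param.1
  have huM := hK.subset h.mem
  have hu := form_self_ne_zero hlam huM
  have hy := (mem_dualBody_iff hlam).1 h.dual
  have habs : 0 < |lam| := abs_pos.2 hlam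
  have hyy : form lam y y ≠ 0 := by rw [hy.1]; exact habs.ne'
  have hXu := h.param.form_fderiv_left
  have hXy := h.param.form_fderiv_right hlam hK h.dual h.orth
  have hXi := h.param.eventually_injective.self_of_nhds
  obtain ⟨p, hp0, hp, hpG, hpU⟩ := h.exists_contact_function hlam hK
  obtain ⟨l, hlX, hlu, hly⟩ := exists_coordinates hXi hu hyy h.orth hXu hXy
  obtain ⟨x, hx, hxy⟩ := h.exists_form_ne_zero hlam hd hK
  have hxK := bd_subset hK hx
  set Y : EuclideanSpace ℝ (Fin (d - 1)) → Ambient d :=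
    fun w => contactVector lam u y φ (w, p w) with hY_def
  have hY : ContDiffAt ℝ 2 Y 0 := contDiffAt_contactVector_two hφ hφ0 hu hp0 hp hpG
  have hY0 : Y 0 = y := by
    simp only [hY_def, hp0]
    exact contactVector_zero hφ0 h.orth
  have hYt : Tendsto Y (𝓝 0) (𝓝 y) := by simpa [hY0] using hY.continuousAt.tendsto
  set r : Ambient d → ℝ := fun z => (√(form lam z z / |lam|))⁻¹ with hr_def
  have hresc := tendsto_rescale habs.ne' hy.1
  have hψ : ContDiffAt ℝ 2 (fun w => r (Y w) • Y w) 0 :=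
    contDiffAt_rescale hY habs.ne' (by rw [hY0, hy.1])
  have hr0 : r y = 1 := by simp [hr_def, hy.1, habs.ne']
  have hpt : Tendsto p (𝓝 0) (𝓝 0) := by simpa [hp0] using hp.continuousAt.tendsto
  have hφt : Tendsto φ (𝓝 0) (𝓝 u) := by simpa [hφ0] using hφ.continuousAt.tendsto
  have hb : ∀ᶠ q in 𝓝 0, form lam u (φ q) ≠ 0 :=
    (hφt.eventually ((continuous_form_right u).continuousAt.eventually_ne hu))
  have hYy : ∀ w, form lam (Y w) y = |lam| := fun w => by
    simp only [hY_def, contactVector, form_add_left, form_smul_left, hXy, h.orth, hy.1]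
    ring
  have hlY : ∀ w, l (Y w) = w := fun w => by
    simp [hY_def, contactVector, hlX, hlu, hly]
  -- As ⟨Y(w), y⟩ = |λ| and l(Y(w)) = w, normalizing the pairing with y to |λ| before applying `l`
  -- undoes the rescaling by r and recovers w.
  set θ : Ambient d → EuclideanSpace ℝ (Fin (d - 1)) :=
    fun z => (|lam| * (form lam z y)⁻¹) • l z with hθ_def
  have hθ : ContDiffAt ℝ 1 θ y := by
    have h1 : ContDiffAt ℝ 1 (fun z => form lam z y) y := by
      have : ContDiffAt ℝ 1 (fun z => formL d lam z y) y := by fun_prop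
      exact this
    exact (contDiffAt_const.mul (h1.inv hyy)).smul l.contDiff.contDiffAt
  have hθ0 : θ y = 0 := by simp [hθ_def, hly]
  refine ⟨fun w => r (Y w) • Y w, isC2Parametrization_of_leftInverse (θ := θ)
    (by simp [hY0, hr0]) hψ hθ ?_ ?_ ?_⟩
  · filter_upwards [hYt.eventually hresc.2] with w hw
    have hrw : r (Y w) ≠ 0 := hw.1.ne'
    simp only [hθ_def, form_smul_left, hYy, map_smul, hlY, smul_smul]
    rw [show |lam| * (r (Y w) * |lam|)⁻¹ * r (Y w) = 1 by field_simp, one_smul]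
  -- A fixed boundary point x off the hyperplane keeps a strict pairing with Y(w) for small w; this
  -- selects the correct one of the two opposite normals.
  · have hxev : ∀ᶠ w in 𝓝 0, 0 < Real.sign lam * form lam x (Y w) := by
      have hc : Continuous fun z => Real.sign lam * form lam x z :=
        continuous_const.mul (continuous_form_right x)
      refine hYt.eventually (hc.continuousAt.eventually (lt_mem_nhds ?_))
      exact lt_of_le_of_ne (hy.2 x hxK) (mul_ne_zero (sign_ne_zero hlam) hxy).symm
    filter_upwards [hxev, hYt.eventually hresc.2, hpG, hpt.eventually hb,
      hpt.eventually hφ.eventually_hasFDerivAt_of_two, hpt.eventually h.param.eventually_injective,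
      hpt.eventually h.param.eventually_mem.eventually_nhds] with w h1 h2 h3 h4 h5 h6 h7
    refine IsStrictContact.mem_bd_dual hlam hd hK hS h5.differentiableAt h6 h7 h2.2 ?_ ?_ hxK ?_
    · rw [form_smul_right, form_comm, form_contactVector (z := (w, p w)) h4, mul_zero]
    · intro v
      have : form lam (Y w) (fderiv ℝ φ (p w) v) = 0 := DFunLike.congr_fun h3 v
      rw [form_smul_right, form_comm, this, mul_zero]
    · rw [form_smul_right, mul_left_comm]
      exact mul_pos h2.1 h1
  · obtain ⟨π, hπ, hπ'⟩ := h.exists_contact_param hlam hd hK hS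
    have hθt : Tendsto θ (𝓝[bd (dualSpaceForm d lam) (dualBody lam K)] y) (𝓝 0) := by
      have := hθ.continuousAt.tendsto
      rw [hθ0] at this
      exact this.mono_left nhdsWithin_le_nhds
    have hpos : ∀ᶠ z in 𝓝[bd (dualSpaceForm d lam) (dualBody lam K)] y, 0 < form lam z y :=
      mem_nhdsWithin_of_mem_nhds ((continuous_form_left y).continuousAt.eventually
        (lt_mem_nhds (by simpa [hy.1] using habs)))
    have hpair : Tendsto (fun z => (θ z, π z))
        (𝓝[bd (dualSpaceForm d lam) (dualBody lam K)] y) (𝓝 0) := hθt.prodMk_nhds hπ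
    filter_upwards [hπ', hpos, hpair.eventually hpU, hπ.eventually hb,
      hπ.eventually hφ.eventually_hasFDerivAt_of_two,
      hπ.eventually h.param.eventually_mem.eventually_nhds, self_mem_nhdsWithin]
      with z h1 h2 h3 h4 h5 h6 h7
    have hz := (mem_dualBody_iff hlam).1 (bd_dual_subset hlam h7)
    have hz1 : ∀ v, form lam (fderiv ℝ φ (π z) v) z = 0 :=
      form_fderiv_eq_zero_of_nonneg h5.differentiableAt (sign_ne_zero hlam)
        (h6.mono fun q hq => hz.2 _ (bd_subset hK hq)) h1
    -- Dividing a boundary point z of K* by its positive y-component b puts it in the form y +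
    -- dφ₀(w) + a' u with w = θ(z). Orthogonality to φ(π(z)) identifies a' as the contact
    -- coefficient, and tangency there gives p(w) = π(z).
    obtain ⟨q, a, b, hzd⟩ := exists_decomposition hd hXi hu hyy h.orth hXu hXy z
    have hzy : form lam z y = b * |lam| := by
      rw [hzd, form_add_left, form_add_left, form_smul_left, form_smul_left, hXy, h.orth, hy.1]
      ring
    have hbpos : 0 < b := by
      rw [hzy] at h2
      exact pos_of_mul_pos_left h2 habs.le
    have hlz : l z = q := by
      rw [hzd]
      simp [hlX, hlu, hly]
    have hθz : q = b • θ z := by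
      simp only [hθ_def, hlz, hzy, smul_smul]
      rw [show b * (|lam| * (b * |lam|)⁻¹) = 1 by field_simp, one_smul]
    have hzv : z = b • contactVector lam u y φ (θ z, π z) := by
      have e1 : z = b • (y + fderiv ℝ φ 0 (θ z) + (a / b) • u) := by
        nth_rewrite 1 [hzd]
        rw [hθz, map_smul, smul_add, smul_add, smul_smul, mul_div_cancel₀ _ hbpos.ne']
        abel
      have e2 : a / b = contactCoeff lam u y φ (θ z, π z) := by
        have e3 := congrArg (form lam (φ (π z))) e1
        rw [h1, form_smul_right, form_add_right, form_smul_right, form_comm _ u,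
          form_comm _ (y + _)] at e3
        have e4 := (mul_eq_zero.1 e3.symm).resolve_left hbpos.ne'
        simp only [contactCoeff, formL_apply]
        rw [← div_eq_mul_inv, eq_div_iff h4]
        linarith
      rw [contactVector, ← e2]
      exact e1
    have hG : contactDiff lam u y φ (θ z, π z) = 0 := by
      ext v
      have e1 := congrArg (form lam (fderiv ℝ φ (π z) v)) hzv
      rw [hz1, form_smul_right, form_comm] at e1
      exact (mul_eq_zero.1 e1.symm).resolve_left hbpos.ne'
    have hpz : p (θ z) = π z := h3 hG
    have hzY : z = b • Y (θ z) := by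
      simp only [hY_def, hpz]
      exact hzv
    -- Both b and r scale Y(θ(z)) to the dual quadric, and both are positive.
    have hrb : r (Y (θ z)) = b := by
      have e1 := hz.1
      rw [hzY, form_smul_left, form_smul_right] at e1
      have e2 : form lam (Y (θ z)) (Y (θ z)) / |lam| = b⁻¹ ^ 2 := by
        rw [div_eq_iff habs.ne', ← e1]
        field_simp
      simp only [hr_def]
      rw [e2, Real.sqrt_sq (inv_nonneg.2 hbpos.le), inv_inv]
    change r (Y (θ z)) • Y (θ z) = z
    rw [hrb, ← hzY]

end DualParametrization

/-! ### Matrices of the second fundamental forms and their determinants -/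

section Determinants

section BilinearMatrix

variable {n : ℕ}

theorem apply_eq_sum_single (f : EuclideanSpace ℝ (Fin n) →L[ℝ] ℝ) (v : EuclideanSpace ℝ (Fin n)) :
    f v = ∑ i, v i * f (EuclideanSpace.single i 1) := by
  have h := (EuclideanSpace.basisFun (Fin n) ℝ).sum_repr v
  conv_lhs => rw [← h]
  simp

/-- The matrix of a bilinear form in the standard basis. -/
def bilinMatrix (L : EuclideanSpace ℝ (Fin n) →L[ℝ] EuclideanSpace ℝ (Fin n) →L[ℝ] ℝ) :
    Matrix (Fin n) (Fin n) ℝ :=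
  Matrix.of fun i j => L (EuclideanSpace.single i 1) (EuclideanSpace.single j 1)

variable (L : EuclideanSpace ℝ (Fin n) →L[ℝ] EuclideanSpace ℝ (Fin n) →L[ℝ] ℝ)

theorem apply_eq_dotProduct (v w : EuclideanSpace ℝ (Fin n)) :
    L v w = dotProduct (v : Fin n → ℝ) ((bilinMatrix L).mulVec w) := by
  have h1 := apply_eq_sum_single (L.flip w) v
  simp only [ContinuousLinearMap.flip_apply] at h1
  rw [h1]
  refine Finset.sum_congr rfl fun i _ => ?_
  rw [apply_eq_sum_single (L (EuclideanSpace.single i 1)) w]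
  simp only [bilinMatrix, Matrix.mulVec, dotProduct, Matrix.of_apply]
  congr 1
  exact Finset.sum_congr rfl fun j _ => mul_comm _ _

theorem det_bilinMatrix_ne_zero (h : ∀ v, v ≠ 0 → L v v ≠ 0) : (bilinMatrix L).det ≠ 0 := by
  intro hdet
  obtain ⟨v, hv, hLv⟩ := Matrix.exists_mulVec_eq_zero_iff.2 hdet
  refine h (WithLp.toLp 2 v) (fun h0 => hv ?_) ?_
  · simpa using congrArg WithLp.ofLp h0
  · rw [apply_eq_dotProduct]
    simp [hLv]

/-- Converts the hypothesis on the curvature, a determinant, into definiteness; semidefiniteness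
comes from support. -/
theorem pos_of_det_bilinMatrix_ne_zero (hsymm : ∀ v w, L v w = L w v) (hnn : ∀ v, 0 ≤ L v v)
    (hdet : (bilinMatrix L).det ≠ 0) {v : EuclideanSpace ℝ (Fin n)} (hv : v ≠ 0) : 0 < L v v := by
  have hpsd : (bilinMatrix L).PosSemidef := by
    refine Matrix.PosSemidef.of_dotProduct_mulVec_nonneg ?_ fun x => ?_
    · ext i j
      simp [bilinMatrix, hsymm (EuclideanSpace.single i 1)]
    · have := hnn (WithLp.toLp 2 x)
      rwa [apply_eq_dotProduct] at this
  have hpd := hpsd.posDef_iff_det_ne_zero.2 hdet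
  rw [apply_eq_dotProduct]
  exact hpd.dotProduct_mulVec_pos (x := v.ofLp) (fun h => hv (by ext i; simpa using congrFun h i))

end BilinearMatrix

variable {d : ℕ} {lam : ℝ} {K : Set (Ambient d)} {u y : Ambient d}
  {φ ψ : EuclideanSpace ℝ (Fin (d - 1)) → Ambient d}

/-- The bilinear map `(v, w) ↦ ∂ᵥ∂_w φ · y` at the origin. -/
def secondForm (lam : ℝ) (y : Ambient d) (φ : EuclideanSpace ℝ (Fin (d - 1)) → Ambient d) :
    EuclideanSpace ℝ (Fin (d - 1)) →L[ℝ] EuclideanSpace ℝ (Fin (d - 1)) →L[ℝ] ℝ :=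
  (ContinuousLinearMap.compL ℝ _ (Ambient d) ℝ (formL d lam y)).comp (fderiv ℝ (fderiv ℝ φ) 0)

theorem secondForm_apply (v w : EuclideanSpace ℝ (Fin (d - 1))) :
    secondForm lam y φ v w = form lam y (fderiv ℝ (fderiv ℝ φ) 0 v w) := rfl

/-- The bilinear map `(v, w) ↦ ∂ᵥφ · ∂_wψ` at the origin. -/
def mixedForm (lam : ℝ) (φ ψ : EuclideanSpace ℝ (Fin (d - 1)) → Ambient d) :
    EuclideanSpace ℝ (Fin (d - 1)) →L[ℝ] EuclideanSpace ℝ (Fin (d - 1)) →L[ℝ] ℝ :=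
  (formL d lam).bilinearComp (fderiv ℝ φ 0) (fderiv ℝ ψ 0)

theorem mixedForm_apply (v w : EuclideanSpace ℝ (Fin (d - 1))) :
    mixedForm lam φ ψ v w = form lam (fderiv ℝ φ 0 v) (fderiv ℝ ψ 0 w) := rfl

theorem firstFundamentalForm_eq : firstFundamentalForm lam φ = bilinMatrix (mixedForm lam φ φ) :=
  rfl

theorem secondFundamentalForm_eq (ν : Ambient d) :
    secondFundamentalForm lam φ ν = form lam ν ν • bilinMatrix (secondForm lam ν φ) := by
  ext i j
  simp [secondFundamentalForm, bilinMatrix, secondForm_apply, form_comm ν]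

theorem bilinMatrix_secondForm_smul (c : ℝ) :
    bilinMatrix (secondForm lam (c • y) φ) = c • bilinMatrix (secondForm lam y φ) := by
  ext i j
  simp [bilinMatrix, secondForm_apply, form_smul_left]

/-- The point u is normal to bd K* at y: its pairing with K*, multiplied by s, is minimal at y. -/
theorem IsC2Parametrization.form_dual_left (hlam : lam ≠ 0)
    (hψ : IsC2Parametrization (bd (dualSpaceForm d lam) (dualBody lam K)) y ψ) (hu : u ∈ K)
    (huy : form lam u y = 0) (v) : form lam (fderiv ℝ ψ 0 v) u = 0 :=
  form_fderiv_eq_zero_of_nonneg (hψ.contDiffAt.differentiableAt (by simp)) (sign_ne_zero hlam)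
    (hψ.eventually_mem.mono fun q hq => by
      rw [form_comm]
      exact ((mem_dualBody_iff hlam).1 (bd_dual_subset hlam hq)).2 u hu)
    (by rw [hψ.1, form_comm, huy]) v

theorem IsC2Parametrization.form_dual_right
    (hψ : IsC2Parametrization (bd (dualSpaceForm d lam) (dualBody lam K)) y ψ) (v) :
    form lam (fderiv ℝ ψ 0 v) y = 0 := by
  have := form_fderiv_self_eq_zero (lam := lam) (hψ.contDiffAt.differentiableAt (by simp))
    (hψ.eventually_mem.mono fun p hp => mem_dualSpaceForm_iff.1 hp.1.1) v
  rwa [hψ.1] at this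

/-- The infinitesimal form of the correspondence between boundary points of `K` and of the dual
body: the two hypersurfaces touch each other's polar hyperplanes. -/
theorem IsStrictContact.second_order_relation (hlam : lam ≠ 0) (hd : 2 ≤ d)
    (hK : IsConvexBody lam K)
    (hS : ∀ u ∈ bd (realSpaceForm d lam) K, ∃ y φ, IsStrictContact lam K u y φ)
    (h : IsStrictContact lam K u y φ)
    (hψ : IsC2Parametrization (bd (dualSpaceForm d lam) (dualBody lam K)) y ψ)
    {q p : EuclideanSpace ℝ (Fin (d - 1))}
    (hqp : ∀ v, mixedForm lam φ ψ v q + secondForm lam y φ p v = 0)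
    (w : EuclideanSpace ℝ (Fin (d - 1))) :
    mixedForm lam φ ψ p w + secondForm lam u ψ q w = 0 := by
  have hφ := h.param.contDiffAt
  have hψc := hψ.contDiffAt
  have h1 := contDiffAt_partialDiff (lam := lam) (g := ψ) (φ := φ) (z := (0, 0))
    (hψc.of_le (by norm_num)) hφ
  have h2 := contDiffAt_partialDiff (lam := lam) (g := φ) (φ := ψ) (z := (0, 0))
    (hφ.of_le (by norm_num)) hψc
  have hd1 := fderiv_partialDiff (lam := lam) (g := ψ) (φ := φ) (z := (0, 0))
    (hψc.of_le (by norm_num)) hφ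
  have hd2 := fderiv_partialDiff (lam := lam) (g := φ) (φ := ψ) (z := (0, 0))
    (hφ.of_le (by norm_num)) hψc
  -- Swapping the arguments makes both tangency relations functions of the same pair (q, p).
  have hsw : HasFDerivAt (fun z : EuclideanSpace ℝ (Fin (d - 1)) × EuclideanSpace ℝ (Fin (d - 1)) =>
      partialDiff lam φ ψ (z.2, z.1)) ((fderiv ℝ (partialDiff lam φ ψ) (0, 0)).comp
        ((ContinuousLinearMap.snd ℝ _ _).prod (.fst ℝ _ _))) (0, 0) :=
    HasFDerivAt.comp (g := partialDiff lam φ ψ)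
      ((0, 0) : EuclideanSpace ℝ (Fin (d - 1)) × EuclideanSpace ℝ (Fin (d - 1)))
      (h2.differentiableAt one_ne_zero).hasFDerivAt (hasFDerivAt_snd.prodMk hasFDerivAt_fst)
  have hinv : (fderiv ℝ (partialDiff lam ψ φ) (0, 0) ∘L .inr ℝ _ _).IsInvertible := by
    refine isInvertible_of_injective_dual ((injective_iff_map_eq_zero _).2 fun p hp => ?_)
    refine h.eq_zero_of_second_eq_zero ?_
    have := DFunLike.congr_fun hp p
    simpa [hd1, hψ.1, form_zero_left] using this
  obtain ⟨π, hπ, hπ'⟩ := h.exists_contact_param hlam hd hK hS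
  have hpt : Tendsto (fun q => π (ψ q)) (𝓝 0) (𝓝 0) := hπ.comp hψ.tendsto
  have hzero1 : partialDiff lam ψ φ (0, 0) = 0 := by
    ext v
    have := h.param.form_fderiv_right hlam hK h.dual h.orth v
    simpa [partialDiff, formL_apply, hψ.1, form_comm y] using this
  have hzero2 : partialDiff lam φ ψ (0, 0) = 0 := by
    ext v
    have := hψ.form_dual_left hlam h.mem h.orth v
    simpa [partialDiff, formL_apply, h.param.1, form_comm u] using this
  -- With p = π(ψ(q)), the vector ψ(q) is normal to bd K at φ(p), and φ(p) is normal to bd K* at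
  -- ψ(q). Both relations hold along the contact curve, so every direction that satisfies the
  -- linearization of the former satisfies that of the latter.
  have key := fderiv_apply_eq_zero_of_implicit (z := (0, 0)) h1 hsw.differentiableAt hinv hpt
    (w := (q, p)) ?_ ?_ ?_
  · rw [hsw.fderiv] at key
    have := DFunLike.congr_fun key w
    simpa [hd2, h.param.1, mixedForm_apply, secondForm_apply] using this
  · filter_upwards [hψ.tendsto.eventually hπ', hψ.eventually_mem,
      hpt.eventually hφ.eventually_hasFDerivAt_of_two,
      hpt.eventually h.param.eventually_mem.eventually_nhds] with q h1 h2 h3 h4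
    rw [hzero1]
    ext v
    have h5 := ((mem_dualBody_iff hlam).1 (bd_dual_subset hlam h2)).2
    have := form_fderiv_eq_zero_of_nonneg h3.differentiableAt (sign_ne_zero hlam)
      (h4.mono fun p' hp' => h5 _ (bd_subset hK hp')) h1 v
    rw [form_comm] at this
    exact this
  · filter_upwards [hψ.tendsto.eventually hπ', hψ.eventually_mem.eventually_nhds,
      hψc.eventually_hasFDerivAt_of_two,
      hpt.eventually h.param.eventually_mem] with q h1 h2 h3 h4
    simp only [hzero2]
    ext v
    rw [form_comm] at h1
    have := form_fderiv_eq_zero_of_nonneg h3.differentiableAt (sign_ne_zero hlam)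
      (h2.mono fun q' hq' => by
        rw [form_comm]
        exact ((mem_dualBody_iff hlam).1 (bd_dual_subset hlam hq')).2 _ (bd_subset hK h4)) h1 v
    rw [form_comm] at this
    exact this
  · ext v
    rw [hd1]
    have := hqp v
    rw [mixedForm_apply, secondForm_apply, form_comm] at this
    simpa [hψ.1] using this

theorem IsStrictContact.det_secondForm_ne_zero (h : IsStrictContact lam K u y φ) :
    (bilinMatrix (secondForm lam y φ)).det ≠ 0 :=
  det_bilinMatrix_ne_zero _ fun _ hv h0 => hv (h.eq_zero_of_second_eq_zero h0)

theorem det_mixedForm_self_ne_zero (hlam : lam ≠ 0) (hu : u ∈ realSpaceForm d lam)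
    (hφi : Function.Injective (fderiv ℝ φ 0)) (hφu : ∀ v, form lam (fderiv ℝ φ 0 v) u = 0) :
    (bilinMatrix (mixedForm lam φ φ)).det ≠ 0 := by
  refine det_bilinMatrix_ne_zero _ fun v hv => ne_of_gt ?_
  exact form_self_pos hlam hu (hφu v) fun h0 => hv (hφi (h0.trans (map_zero _).symm))

/-- The linearized contact relations amount to C = Bᵀ A⁻¹ B. -/
theorem IsStrictContact.det_mul_det (hlam : lam ≠ 0) (hd : 2 ≤ d) (hK : IsConvexBody lam K)
    (hS : ∀ u ∈ bd (realSpaceForm d lam) K, ∃ y φ, IsStrictContact lam K u y φ)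
    (h : IsStrictContact lam K u y φ)
    (hψ : IsC2Parametrization (bd (dualSpaceForm d lam) (dualBody lam K)) y ψ) :
    (bilinMatrix (secondForm lam y φ)).det * (bilinMatrix (secondForm lam u ψ)).det =
      (bilinMatrix (mixedForm lam φ ψ)).det ^ 2 := by
  set A := bilinMatrix (secondForm lam y φ) with hA
  set B := bilinMatrix (mixedForm lam φ ψ) with hB
  set C := bilinMatrix (secondForm lam u ψ) with hC
  have hdet : IsUnit Aᵀ.det := by
    rw [Matrix.det_transpose]
    exact isUnit_iff_ne_zero.2 h.det_secondForm_ne_zero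
  -- The j-th column of Q is the displacement p of the contact parameter that corresponds to q = eⱼ.
  obtain ⟨Q, hQ⟩ : ∃ Q, Aᵀ * Q = -B := ⟨Aᵀ⁻¹ * -B, by rw [Matrix.mul_nonsing_inv_cancel_left _ _ hdet]⟩
  have hCQ : C = Qᵀ * -B := by
    ext j l
    have hrel := h.second_order_relation hlam hd hK hS hψ (q := EuclideanSpace.single j 1)
      (p := WithLp.toLp 2 fun k => Q k j) (fun v => ?_) (EuclideanSpace.single l 1)
    · have h1 := apply_eq_sum_single
        ((mixedForm lam φ ψ).flip (EuclideanSpace.single l 1)) (WithLp.toLp 2 fun k => Q k j)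
      simp only [ContinuousLinearMap.flip_apply] at h1
      rw [h1] at hrel
      simp only [Matrix.mul_apply, Matrix.transpose_apply, Matrix.neg_apply, mul_neg,
        Finset.sum_neg_distrib]
      exact (neg_eq_of_add_eq_zero_right hrel).symm
    · have h0 : (mixedForm lam φ ψ).flip (EuclideanSpace.single j 1)
          + secondForm lam y φ (WithLp.toLp 2 fun k => Q k j) = 0 := by
        ext v
        rw [apply_eq_sum_single]
        refine Finset.sum_eq_zero fun i _ => mul_eq_zero_of_right _ ?_
        have h1 := apply_eq_sum_single
          ((secondForm lam y φ).flip (EuclideanSpace.single i 1)) (WithLp.toLp 2 fun k => Q k j)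
        simp only [ContinuousLinearMap.flip_apply] at h1
        rw [add_apply, ContinuousLinearMap.flip_apply, h1]
        have h2 := congrFun (congrFun hQ i) j
        simp only [Matrix.mul_apply, Matrix.transpose_apply, Matrix.neg_apply] at h2
        have h3 : B i j = mixedForm lam φ ψ (EuclideanSpace.single i 1)
          (EuclideanSpace.single j 1) := rfl
        rw [← h3, ← neg_eq_iff_add_eq_zero, ← h2]
        exact Finset.sum_congr rfl fun k _ => mul_comm _ _
      exact DFunLike.congr_fun h0 v
  have h1 : A.det * Q.det = (-B).det := by rw [← hQ, Matrix.det_mul, Matrix.det_transpose]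
  have h2 : (-B).det * (-B).det = B.det ^ 2 := by
    rw [← Matrix.det_mul, neg_mul_neg, Matrix.det_mul, sq]
  rw [hCQ, Matrix.det_mul, Matrix.det_transpose, ← mul_assoc, h1, h2]

/-- Two bases of the same space: the determinants of the Gram matrices. -/
theorem det_mixedForm_sq (hlam : lam ≠ 0) (hd : 2 ≤ d) (hu : u ∈ realSpaceForm d lam)
    (hy : form lam y y ≠ 0) (huy : form lam u y = 0) (hφi : Function.Injective (fderiv ℝ φ 0))
    (hφu : ∀ v, form lam (fderiv ℝ φ 0 v) u = 0) (hφy : ∀ v, form lam (fderiv ℝ φ 0 v) y = 0)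
    (hψu : ∀ v, form lam (fderiv ℝ ψ 0 v) u = 0) (hψy : ∀ v, form lam (fderiv ℝ ψ 0 v) y = 0) :
    (bilinMatrix (mixedForm lam φ ψ)).det ^ 2 =
      (bilinMatrix (mixedForm lam φ φ)).det * (bilinMatrix (mixedForm lam ψ ψ)).det := by
  have huu := form_self_ne_zero hlam hu
  -- The image of dψ is orthogonal to u and y, hence contained in that of dφ. The matrix R of this
  -- change of basis gives the mixed matrix as G R and the Gram matrix of ψ as Rᵀ G R, where G is
  -- that of φ.
  have hex : ∀ j : Fin (d - 1), ∃ r, fderiv ℝ ψ 0 (EuclideanSpace.single j 1) = fderiv ℝ φ 0 r := by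
    intro j
    obtain ⟨p, a, b, h⟩ := exists_decomposition hd hφi huu hy huy hφu hφy
      (fderiv ℝ ψ 0 (EuclideanSpace.single j 1))
    have ha := congrArg (form lam · u) h
    have hb := congrArg (form lam · y) h
    simp only [form_add_left, form_smul_left, hφu, hφy, hψu, hψy, huy, form_comm y u,
      mul_zero, zero_add, add_zero, zero_eq_mul, huu, hy, or_false] at ha hb
    exact ⟨p, by rw [h, ha, hb]; simp⟩
  choose r hr using hex
  set R : Matrix (Fin (d - 1)) (Fin (d - 1)) ℝ := Matrix.of fun k j => r j k
  have h1 : bilinMatrix (mixedForm lam φ ψ) = bilinMatrix (mixedForm lam φ φ) * R := by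
    ext i j
    rw [Matrix.mul_apply]
    have h2 := apply_eq_sum_single (mixedForm lam φ φ (EuclideanSpace.single i 1)) (r j)
    simp only [bilinMatrix, Matrix.of_apply, R, mixedForm_apply, hr] at h2 ⊢
    rw [h2]
    exact Finset.sum_congr rfl fun k _ => mul_comm _ _
  have h2 : bilinMatrix (mixedForm lam ψ ψ) = Rᵀ * bilinMatrix (mixedForm lam φ ψ) := by
    ext i j
    rw [Matrix.mul_apply]
    have h3 := apply_eq_sum_single
      ((mixedForm lam φ ψ).flip (EuclideanSpace.single j 1)) (r i)
    simp only [bilinMatrix, Matrix.of_apply, R, mixedForm_apply, hr, Matrix.transpose_apply,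
      ContinuousLinearMap.flip_apply] at h3 ⊢
    rw [h3]
  rw [h2, h1, Matrix.det_mul, Matrix.det_mul, Matrix.det_mul, Matrix.det_transpose]
  ring

end Determinants

/-! ### Unit normals, strict contact and the product of the curvatures -/

section Curvature

variable {d : ℕ} {lam : ℝ} {K : Set (Ambient d)} {u y ν : Ambient d}
  {φ ψ : EuclideanSpace ℝ (Fin (d - 1)) → Ambient d}

/-- Tangent spaces of the real space form are definite, so the time-like alternative occurs only for
dual bodies. -/
theorem IsInnerUnitNormal.form_self (hlam : lam ≠ 0) (hu : u ∈ realSpaceForm d lam)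
    (hν : IsInnerUnitNormal lam K u ν) : form lam ν ν = 1 := by
  rcases hν.1 with h | h
  · exact h
  · have hne : ν ≠ 0 := by
      rintro rfl
      rw [form_zero_left] at h
      norm_num at h
    have := form_self_pos hlam hu hν.2.1 hne
    linarith

/-- An inner unit normal of `K`, suitably scaled, is a point of the dual body. -/
theorem IsInnerUnitNormal.smul_mem_dualBody (hlam : lam ≠ 0) (hu : u ∈ realSpaceForm d lam)
    (hν : IsInnerUnitNormal lam K u ν) : (Real.sign lam * √|lam|) • ν ∈ dualBody lam K := by
  have h1 := hν.form_self hlam hu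
  have h2 := sign_mul_sign hlam
  have h3 := Real.mul_self_sqrt (abs_nonneg lam)
  rw [mem_dualBody_iff hlam]
  constructor
  · rw [form_smul_left, form_smul_right, h1]
    linear_combination √|lam| * √|lam| * h2 + h3
  · intro x hx
    have h4 := hν.2.2 x hx
    rw [h1, one_mul] at h4
    rw [form_smul_right, form_comm]
    have h5 : Real.sign lam * (Real.sign lam * √|lam| * form lam ν x) = √|lam| * form lam ν x := by
      linear_combination √|lam| * form lam ν x * h2
    rw [h5]
    positivity

theorem secondForm_symm (hφ : ContDiffAt ℝ 2 φ 0) (v w : EuclideanSpace ℝ (Fin (d - 1))) :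
    secondForm lam y φ v w = secondForm lam y φ w v := by
  have : IsSymmSndFDerivAt ℝ φ 0 := hφ.isSymmSndFDerivAt (by simp)
  rw [secondForm_apply, secondForm_apply, this v w]

/-- A boundary point at which the Gauss--Kronecker curvature is positive. -/
theorem HasGaussKronecker.exists_isStrictContact (hlam : lam ≠ 0)
    (hK : IsConvexBody lam K) (hu : u ∈ bd (realSpaceForm d lam) K) {κ : ℝ} (hκ : 0 < κ)
    (h : HasGaussKronecker lam (realSpaceForm d lam) K u κ) :
    ∃ y φ, IsStrictContact lam K u y φ := by
  obtain ⟨φ, ν, hφ, hν, -, hκ'⟩ := h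
  have huM := hu.1.1
  have hν1 := hν.form_self hlam huM
  have hdual := hν.smul_mem_dualBody hlam huM
  have huν : form lam u ((Real.sign lam * √|lam|) • ν) = 0 := by
    rw [form_smul_right, form_comm, hν.2.1, mul_zero]
  refine ⟨(Real.sign lam * √|lam|) • ν, φ, bd_subset hK hu, hdual, huν, hφ, fun v hv => ?_⟩
  have hdet : (bilinMatrix (secondForm lam ν φ)).det ≠ 0 := by
    intro h0
    rw [secondFundamentalForm_eq, hν1, one_smul, h0, zero_div] at hκ'
    exact hκ.ne' hκ'
  obtain ⟨h1, h2⟩ := hasFDerivAt_clm_comp_fderiv hφ.contDiffAt (formL d lam ν)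
  have hmin : IsLocalMin (fun q => formL d lam ν (φ q)) 0 := by
    filter_upwards [hφ.eventually_mem] with q hq
    have h3 := hν.2.2 _ (bd_subset hK hq)
    rw [hν1, one_mul] at h3
    simpa only [formL_apply, hφ.1, hν.2.1] using h3
  have hpos := pos_of_det_bilinMatrix_ne_zero (secondForm lam ν φ)
    (secondForm_symm hφ.contDiffAt) (second_deriv_nonneg_of_isLocalMin h1 h2 hmin) hdet hv
  rw [secondForm_apply] at hpos
  have h2 := sign_mul_sign hlam
  have h3 : 0 < √|lam| := Real.sqrt_pos.2 (abs_pos.2 hlam)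
  rw [form_smul_left]
  have h5 : Real.sign lam * (Real.sign lam * √|lam| * form lam ν (fderiv ℝ (fderiv ℝ φ) 0 v v)) =
      √|lam| * form lam ν (fderiv ℝ (fderiv ℝ φ) 0 v v) := by
    linear_combination √|lam| * form lam ν (fderiv ℝ (fderiv ℝ φ) 0 v v) * h2
  rw [h5]
  positivity

/-- The unit normal of K* is thus time-like exactly when λ < 0. -/
theorem form_smul_sqrt_self (hlam : lam ≠ 0) (hu : u ∈ realSpaceForm d lam) :
    form lam (√|lam| • u) (√|lam| • u) = Real.sign lam := by
  rw [form_smul_left, form_smul_right, hu.1, ← mul_assoc, Real.mul_self_sqrt (abs_nonneg lam),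
    mul_one_div, div_eq_iff hlam]
  nth_rewrite 3 [← sign_mul_abs hlam]
  rw [← mul_assoc, sign_mul_sign hlam, one_mul]

theorem IsStrictContact.isInnerUnitNormal_dual (hlam : lam ≠ 0) (hK : IsConvexBody lam K)
    (h : IsStrictContact lam K u y φ) :
    IsInnerUnitNormal (1 / lam) (dualBody lam K) y (√|lam| • u) := by
  have h1 := form_smul_sqrt_self hlam (hK.subset h.mem)
  rw [IsInnerUnitNormal, form_one_div, h1]
  refine ⟨mul_self_eq_one_iff.1 (sign_mul_sign hlam), ?_, fun z hz => ?_⟩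
  · rw [form_smul_left, h.orth, mul_zero]
  · rw [form_smul_left, mul_left_comm]
    exact mul_nonneg (Real.sqrt_nonneg _) (((mem_dualBody_iff hlam).1 hz).2 u h.mem)

/-- The inner unit normal of the dual body at `y` is the rescaled point `u`. -/
theorem IsStrictContact.dual_normal_eq (hlam : lam ≠ 0) (hd : 2 ≤ d) (hK : IsConvexBody lam K)
    (h : IsStrictContact lam K u y φ)
    (hψ : IsC2Parametrization (bd (dualSpaceForm d lam) (dualBody lam K)) y ψ)
    (hν : IsInnerUnitNormal (1 / lam) (dualBody lam K) y ν)
    (hνψ : ∀ v, form (1 / lam) ν (fderiv ℝ ψ 0 v) = 0) : ν = √|lam| • u := by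
  rw [IsInnerUnitNormal, form_one_div] at hν
  rw [form_one_div] at hνψ
  have huM := hK.subset h.mem
  have hu := form_self_ne_zero hlam huM
  have hy := (mem_dualBody_iff hlam).1 h.dual
  have hyy : form lam y y ≠ 0 := by rw [hy.1]; exact abs_ne_zero.2 hlam
  have hψu := hψ.form_dual_left hlam h.mem h.orth
  have hψy := hψ.form_dual_right
  obtain ⟨p, a, b, hdec⟩ := exists_decomposition hd hψ.eventually_injective.self_of_nhds hu hyy
    h.orth hψu hψy ν
  have hb : b = 0 := by
    have := congrArg (form lam · y) hdec
    simp only [form_add_left, form_smul_left, hψy, h.orth, hν.2.1, mul_zero, zero_add,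
      zero_eq_mul, hyy, or_false] at this
    exact this
  have hp : fderiv ℝ ψ 0 p = 0 := by
    by_contra hne
    have h1 := form_self_pos hlam huM (hψu p) hne
    have h2 := congrArg (form lam · (fderiv ℝ ψ 0 p)) hdec
    simp only [form_add_left, form_smul_left, hνψ, form_comm u, form_comm y, hψu, hψy,
      mul_zero, add_zero] at h2
    linarith
  have hνa : ν = a • u := by rw [hdec, hb, hp]; simp
  have h1 := form_smul_sqrt_self hlam huM
  have hsu : form lam u u = Real.sign lam * |lam|⁻¹ := by
    rw [form_smul_left, form_smul_right, ← mul_assoc, Real.mul_self_sqrt (abs_nonneg lam)] at h1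
    rw [← h1, mul_comm |lam|, mul_assoc, mul_inv_cancel₀ (abs_ne_zero.2 hlam), mul_one]
  have hνν : form lam ν ν = a * a * |lam|⁻¹ * Real.sign lam := by
    rw [hνa, form_smul_left, form_smul_right, hsu]
    ring
  have hs := sign_mul_sign hlam
  have habs : 0 < |lam| := abs_pos.2 hlam
  -- The normalization ±1 leaves the sign open, but a²/|λ| is nonnegative.
  have haa : a * a * |lam|⁻¹ = 1 := by
    have hnn : 0 ≤ a * a * |lam|⁻¹ := mul_nonneg (mul_self_nonneg a) (inv_nonneg.2 habs.le)
    have hsq : (a * a * |lam|⁻¹) * (a * a * |lam|⁻¹) = 1 := by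
      have h2 : form lam ν ν * form lam ν ν = 1 := mul_self_eq_one_iff.2 hν.1
      rw [hνν] at h2
      linear_combination h2 - (a * a * |lam|⁻¹) * (a * a * |lam|⁻¹) * hs
    rcases mul_self_eq_one_iff.1 hsq with h3 | h3
    · exact h3
    · linarith
  rw [haa, one_mul] at hνν
  have haa' : a * a = √|lam| * √|lam| := by
    rw [Real.mul_self_sqrt habs.le]
    field_simp at haa
    linarith
  rcases mul_self_eq_mul_self_iff.1 haa' with h3 | h3
  · rw [hνa, h3]
  -- With the opposite sign, K* would satisfy both inequalities for u. All boundary points of K*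
  -- near y would be orthogonal to u, hence equal to y, and ψ would be constant.
  · exfalso
    refine hψ.not_eventually_const hd ?_
    filter_upwards [hψ.eventually_mem] with q hq
    have hq' := bd_dual_subset hlam hq
    refine h.dual_eq_of_form_eq_zero hlam hd hK hq' ?_
    have h4 := ((mem_dualBody_iff hlam).1 hq').2 u h.mem
    have h5 := hν.2.2 _ hq'
    rw [hνν, hνa, h3, form_smul_left] at h5
    have h6 : 0 < √|lam| := Real.sqrt_pos.2 habs
    have h7 : Real.sign lam * form lam u (ψ q) ≤ 0 := by
      by_contra! hlt
      have := mul_pos h6 hlt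
      linarith
    have h8 : Real.sign lam * form lam u (ψ q) = 0 := le_antisymm h7 h4
    exact (mul_eq_zero.1 h8).resolve_left (sign_ne_zero hlam)

/-- The Gauss--Kronecker curvatures at corresponding points are reciprocal. -/
theorem IsStrictContact.curvature_mul_curvature (hlam : lam ≠ 0) (hd : 2 ≤ d)
    (hK : IsConvexBody lam K)
    (hS : ∀ u ∈ bd (realSpaceForm d lam) K, ∃ y φ, IsStrictContact lam K u y φ)
    (h : IsStrictContact lam K u y φ)
    (hψ : IsC2Parametrization (bd (dualSpaceForm d lam) (dualBody lam K)) y ψ)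
    (hν : form lam ν ν = 1) (hy : y = (Real.sign lam * √|lam|) • ν) :
    (secondFundamentalForm lam φ ν).det / (firstFundamentalForm lam φ).det *
      ((secondFundamentalForm (1 / lam) ψ (√|lam| • u)).det /
        (firstFundamentalForm (1 / lam) ψ).det) = 1 := by
  have huM := hK.subset h.mem
  have hyy := ((mem_dualBody_iff hlam).1 h.dual).1
  have hψu := hψ.form_dual_left hlam h.mem h.orth
  have hinv : firstFundamentalForm (1 / lam) ψ = bilinMatrix (mixedForm lam ψ ψ) := by
    rw [← firstFundamentalForm_eq, firstFundamentalForm, firstFundamentalForm, form_one_div]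
  have hinv2 : secondFundamentalForm (1 / lam) ψ (√|lam| • u) =
      (Real.sign lam * √|lam|) • bilinMatrix (secondForm lam u ψ) := by
    have : secondFundamentalForm (1 / lam) ψ (√|lam| • u) =
        secondFundamentalForm lam ψ (√|lam| • u) := by
      rw [secondFundamentalForm, secondFundamentalForm, form_one_div]
    rw [this, secondFundamentalForm_eq, form_smul_sqrt_self hlam huM, bilinMatrix_secondForm_smul,
      smul_smul]
  have hφg := det_mixedForm_self_ne_zero hlam huM h.param.eventually_injective.self_of_nhds
    h.param.form_fderiv_left
  have hψg := det_mixedForm_self_ne_zero hlam huM hψ.eventually_injective.self_of_nhds hψu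
  have hmain := h.det_mul_det hlam hd hK hS hψ
  rw [det_mixedForm_sq hlam hd huM (by rw [hyy]; exact abs_ne_zero.2 hlam) h.orth
    h.param.eventually_injective.self_of_nhds h.param.form_fderiv_left
    (h.param.form_fderiv_right hlam hK h.dual h.orth) hψu hψ.form_dual_right] at hmain
  rw [hinv, hinv2, firstFundamentalForm_eq, secondFundamentalForm_eq, hν, one_smul,
    div_mul_div_comm, div_eq_one_iff_eq (mul_ne_zero hφg hψg), ← hmain, hy,
    bilinMatrix_secondForm_smul, Matrix.det_smul, Matrix.det_smul]
  ring

end Curvature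

end SpaceForm

end

theorem mainTheorem9 (d : ℕ) (hd : 2 ≤ d) (lam : ℝ) (hlam : lam ≠ 0)
    (K : Set (SpaceForm.Ambient d))
    (hK : SpaceForm.IsConvexBody lam K) (hC : SpaceForm.IsC2Plus lam K) :
    ∀ u ∈ SpaceForm.bd (SpaceForm.realSpaceForm d lam) K,
      ∃ us ∈ SpaceForm.bd (SpaceForm.dualSpaceForm d lam) (SpaceForm.dualBody lam K),
        -- `us` is the only point of the dual body that is orthogonal to `u`
        SpaceForm.form lam u us = 0 ∧
        (∀ y ∈ SpaceForm.dualBody lam K, SpaceForm.form lam u y = 0 → y = us) ∧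
        -- `us` is the inner (`lam > 0`) or outer (`lam < 0`) normal of `K` at `u`, scaled
        (∀ ν, SpaceForm.IsInnerUnitNormal lam K u ν →
          us = (Real.sign lam * √|lam|) • ν) ∧
        -- both curvatures exist, and any values of them multiply to `1`
        (∃ κ, SpaceForm.HasGaussKronecker lam (SpaceForm.realSpaceForm d lam) K u κ) ∧
        (∃ κs, SpaceForm.HasGaussKronecker (1 / lam) (SpaceForm.dualSpaceForm d lam)
          (SpaceForm.dualBody lam K) us κs) ∧
        ∀ κ κs, SpaceForm.HasGaussKronecker lam (SpaceForm.realSpaceForm d lam) K u κ →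
          SpaceForm.HasGaussKronecker (1 / lam) (SpaceForm.dualSpaceForm d lam)
            (SpaceForm.dualBody lam K) us κs →
          κ * κs = 1 := by
  intro u hu
  have hS : ∀ u ∈ SpaceForm.bd (SpaceForm.realSpaceForm d lam) K,
      ∃ y φ, SpaceForm.IsStrictContact lam K u y φ := fun u hu => by
    obtain ⟨κ, hκ, h⟩ := hC u hu
    exact h.exists_isStrictContact hlam hK hu hκ
  obtain ⟨y, φ, h⟩ := hS u hu
  obtain ⟨ψ, hψ⟩ := h.exists_dual_param hlam hd hK hS
  have hnormal : ∀ ν, SpaceForm.IsInnerUnitNormal lam K u ν →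
      y = (Real.sign lam * √|lam|) • ν := fun ν hν =>
    (h.dual_eq_of_form_eq_zero hlam hd hK (hν.smul_mem_dualBody hlam hu.1.1)
      (by rw [SpaceForm.form_smul_right, SpaceForm.form_comm, hν.2.1, mul_zero])).symm
  refine ⟨y, SpaceForm.mem_bd_dual_of_form_eq_zero hlam hK h.mem h.dual h.orth, h.orth,
    fun z hz huz => h.dual_eq_of_form_eq_zero hlam hd hK hz huz, hnormal,
    (hC u hu).imp fun κ hκ => hκ.2, ⟨_, ψ, √|lam| • u, hψ, h.isInnerUnitNormal_dual hlam hK,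
      fun v => ?_, rfl⟩, ?_⟩
  · rw [SpaceForm.form_one_div, SpaceForm.form_smul_left, SpaceForm.form_comm,
      hψ.form_dual_left hlam h.mem h.orth, mul_zero]
  · rintro κ κs ⟨φ₁, ν₁, hφ₁, hν₁, -, rfl⟩ ⟨ψ₁, ν₂, hψ₁, hν₂, hνψ, rfl⟩
    rw [h.dual_normal_eq hlam hd hK hψ₁ hν₂ hνψ]
    -- Quadratic growth carries definiteness over to the arbitrary parametrization that is used for
    -- κ, so the identity does not depend on the choice.
    have h₁ : SpaceForm.IsStrictContact lam K u y φ₁ :=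
      .of_growth h.mem h.dual h.orth hφ₁ (h.growth hlam hK)
    exact h₁.curvature_mul_curvature hlam hd hK hS hψ₁ (hν₁.form_self hlam hu.1.1) (hnormal ν₁ hν₁)
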